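/- Let $I_1,I_2,I_3>0$ be not all equal and let $d>0$. Put $a_i=1/(I_i+d)$, $\mathbf A=\mathrm{diag}(a_1,a_2,a_3)$, $\mathbf B=\mathrm{diag}(b_1,b_2,b_3)$ with $b_i=\sum_j (I_j+d)-2(I_i+d)$, and, on the space $e^*(3)=\mathbb R^6$ with coordinates $(\gamma,M)$, $\gamma,M\in\mathbb R^3$, $$\mathrm g(\gamma)=\sqrt{1-d(\gamma,\mathbf A\gamma)},\quad C_1=(\gamma,\gamma),\quad C_2=(\gamma,\mathbf BM),\quad \alpha_k=C_2+b_k(\gamma,M).$$ Write $\Gamma_{ij}=\varepsilon_{ijk}\gamma_k$, $\mathbf M_{ij}=\varepsilon_{ijk}M_k$, $(\Gamma_b)_{ij}=\varepsilon_{ijk}b_k\gamma_k$ (sums over $k$). Consider the canonical Lie–Poisson bivector $P$ and the bivectors $P_g$, $P_b$ on $U=\{d(\gamma,\mathbf A\gamma)<1\}$, where $$P=\begin{pmatrix}0&\Gamma\\-\Gamma^\top&\mathbf M\end{pmatrix},\qquad P_g=\mathrm g\,P-d\,\mathrm g^{-1}(M,\mathbf A\gamma)\begin{pmatrix}0&0\\0&\Gamma\end{pmatrix},$$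 $$P_b=\mathrm g\begin{pmatrix}0&\hat\Gamma\\-\hat\Gamma^\top&\hat{\mathbf M}\end{pmatrix}+\mathrm g^{-1}\bigl(2d(\gamma,\gamma)-\mathrm{tr}\,\mathbf B\bigr)\begin{pmatrix}0&0\\0&\tilde\Gamma\end{pmatrix},$$ $$\hat\Gamma=\Bigl((\gamma,\gamma)\mathbf E-\gamma\gamma^\top-\tfrac1{2d}\mathbf B\Bigr)\Gamma_b,\qquad \hat{\mathbf M}_{ij}=-\varepsilon_{ijk}\Bigl(\alpha_k\gamma_k-(\gamma,\gamma)b_kM_k+\tfrac{b_k^2M_k}{2d}\Bigr),$$ $$\tilde\Gamma_{ij}=-\frac{\varepsilon_{ijk}b_k\gamma_k}{(b_1+b_2)(b_2+b_3)(b_1+b_3)}\Bigl((b_i+b_j)\alpha_k+(b_k-b_i)(b_k-b_j)M_k\gamma_k\Bigr).$$ Let $[\cdot,\cdot]$ be the Schouten bracket. Then the following hold. 1. $P_b$ is a smooth Poisson bivector on $U$, i.e. $[P_b,P_b]=0$. 2. $[P,P_g]=0$ on $U$, whereas $[P,P_b]$ does not vanish identically on any nonempty open subset of $U$. 3. $P_b$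 is not a trivial deformation of $P$: on no nonempty open subset $W\subseteq U$ is there a smooth vector field $Y$ with $P_b=\mathcal L_YP$ (that is, $P_b$ is not a coboundary in the Poisson–Lichnerowicz complex of $P$). 4. Nevertheless $P_b$ is reduced to $P$ by a change of variables. Let $b_1,b_2\ne0$, put $$s(\gamma)=4d^2(\gamma,\gamma)(\gamma,\mathbf B\gamma)-2d\bigl((\mathbf E\,\mathrm{tr}\,\mathbf B-\mathbf B)\gamma,\mathbf B\gamma\bigr)+\det\mathbf B,\qquad \rho=\gamma_1^2+\gamma_2^2,$$ $$A_1=2d\gamma_2\bigl(2db_1\gamma_1^2+2db_2(\gamma_2^2+\gamma_3^2)-b_1b_2\bigr),\qquad A_2=-2d\gamma_1\bigl(2db_1(\gamma_1^2+\gamma_3^2)+2db_2\gamma_2^2-b_1b_2\bigr),$$ $$A_3=4d^2\gamma_1\gamma_2\gamma_3(b_1-b_2),$$ $$\beta_1=-2d\gamma_1\gamma_3\Bigl(2d\bigl(\gamma_2^2(b_1b_2-b_1b_3+b_2b_3)+b_2(b_1\gamma_1^2+b_3\gamma_3^2)\bigr)-b_1b_2b_3\Bigr),$$ $$\beta_2=-2d\gamma_2\gamma_3\Bigl(2d\bigl(\gamma_1^2(b_1b_3+b_1b_2-b_2b_3)+b_1(b_2\gamma_2^2+b_3\gamma_3^2)\bigr)-b_1b_2b_3\Bigr),$$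 $$\beta_3=4d^2b_3\gamma_3^2(b_2\gamma_1^2+b_1\gamma_2^2)+2db_1b_2\rho\,(2d\rho-b_3),$$ and let $V$ be an open subset of $\{\gamma:\ d(\gamma,\mathbf A\gamma)<1,\ s(\gamma)\neq0,\ \rho\ne0\}$ which meets every meridian in a connected set (a meridian is an open half great circle, joining the poles on the $\gamma_3$-axis, of a sphere $(\gamma,\gamma)=\mathrm{const}$); every $\gamma$ with $d(\gamma,\mathbf A\gamma)<1$, $s(\gamma)\ne0$, $\rho\neq0$ has such a neighbourhood $V$. Then there is a smooth function $h$ on $V$ such that for every smooth function $\varphi(t,y)$ ($t>0$, $y\in\mathbb R$), with $c=\varphi(C_1,C_2)$, $m=b_1\gamma_2M_1-b_2\gamma_1M_2$ and $$L_i=\frac1{\mathrm g\,s\,b_1b_2\,\rho}\Bigl(A_im+\beta_iM_3+\frac{C_2\gamma_i\gamma_3h}{\rho}\Bigr)+\frac{c\gamma_i}{\rho}\quad(i=1,2),\qquad L_3=\frac1{\mathrm g\,s\,b_1b_2\,\rho}\bigl(A_3m+\beta_3M_3-C_2h\bigr),$$ one has on $V\times\mathbb R^3$: $(\gamma,L)=c$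 and $$\{L_i,L_j\}_b=\varepsilon_{ijk}L_k,\qquad\{L_i,\gamma_j\}_b=\varepsilon_{ijk}\gamma_k,\qquad\{\gamma_i,\gamma_j\}_b=0,$$ i.e. $(\gamma,M)\mapsto(\gamma,L)$ takes $P_b$ to $P$. If moreover for every $t>0$ the map $\varphi(t,\cdot)$ is a bijection of $\mathbb R$ with nowhere vanishing derivative (e.g. $c=C_2$), then $(\gamma,M)\mapsto(\gamma,L)$ is a diffeomorphism of $V\times\mathbb R^3$ onto itself. -/

import Mathlib

open scoped Matrix ContDiff

noncomputable section

namespace ChaplyginSphere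

/-! ### Bivector fields on the phase space with coordinates `(γ, M)` -/

/-- The phase space `e*(3)`: a point `x` has coordinates `γ i = x (Sum.inl i)` and
`M i = x (Sum.inr i)`. -/
abbrev Phase : Type := Fin 3 ⊕ Fin 3 → ℝ

/-- The vector `γ` of a phase point. -/
def gam (x : Phase) : Fin 3 → ℝ := fun i => x (Sum.inl i)

/-- The vector `M` of a phase point. -/
def mom (x : Phase) : Fin 3 → ℝ := fun i => x (Sum.inr i)

/-- Bivector fields, as matrices of functions `P i j = {x i, x j}` in the coordinates `(γ, M)`.
Skew-symmetry is part of `IsPoissonOn`. -/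
abbrev BivectorField : Type := Phase → Matrix (Fin 3 ⊕ Fin 3) (Fin 3 ⊕ Fin 3) ℝ

/-- The partial derivative of `f` with respect to the coordinate number `l`. -/
def pd (f : Phase → ℝ) (l : Fin 3 ⊕ Fin 3) (x : Phase) : ℝ := fderiv ℝ f x (Pi.single l 1)

/-- The bracket `{f, g} = ∑ P i j ∂ᵢf ∂ⱼg` of a bivector field. -/
def bracket (P : BivectorField) (f g : Phase → ℝ) (x : Phase) : ℝ :=
  ∑ i, ∑ j, P x i j * pd f i x * pd g j x

/-- The components `[P, Q]ⁱʲᵏ` of the Schouten bracket of two bivector fields (normalised so that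
`[P, P] = 0` is twice the Jacobi identity; a different normalisation or sign does not
change when it vanishes). -/
def schouten (P Q : BivectorField) (x : Phase) (i j k : Fin 3 ⊕ Fin 3) : ℝ :=
  ∑ l,
    (P x i l * pd (fun y => Q y j k) l x + Q x i l * pd (fun y => P y j k) l x
      + (P x j l * pd (fun y => Q y k i) l x + Q x j l * pd (fun y => P y k i) l x)
      + (P x k l * pd (fun y => Q y i j) l x + Q x k l * pd (fun y => P y i j) l x))

/-- The components of the Lie derivative of a bivector field `P` along a vector field `Y`. -/
def lieDerivBivector (Y : Phase → Phase) (P : BivectorField) (x : Phase)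
    (i j : Fin 3 ⊕ Fin 3) : ℝ :=
  ∑ l, (Y x l * pd (fun y => P y i j) l x - P x l j * pd (fun y => Y y i) l x
    - P x i l * pd (fun y => Y y j) l x)

/-- `P` is a smooth Poisson bivector on the open set `U`. -/
def IsPoissonOn (P : BivectorField) (U : Set Phase) : Prop :=
  (∀ i j, ContDiffOn ℝ ∞ (fun x => P x i j) U) ∧
  (∀ x ∈ U, ∀ i j, P x j i = -P x i j) ∧
  (∀ x ∈ U, ∀ i j k, schouten P P x i j k = 0)

/-- `[P, Q] = 0` on `U`. -/
def CompatibleOn (P Q : BivectorField) (U : Set Phase) : Prop :=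
  ∀ x ∈ U, ∀ i j k, schouten P Q x i j k = 0

/-- `Q` is a trivial deformation of `P` on `U`: it is a coboundary `L_Y P` in the
Poisson-Lichnerowicz complex of `P`, for a smooth vector field `Y` on `U`. -/
def IsTrivialDeformationOn (P Q : BivectorField) (U : Set Phase) : Prop :=
  ∃ Y : Phase → Phase, ContDiffOn ℝ ∞ Y U ∧
    ∀ x ∈ U, ∀ i j, Q x i j = lieDerivBivector Y P x i j

/-- On the open set `U` the map `F` takes the bivector field `P` to the bivector field `Q`:
the `P`-brackets of the new coordinates `F i` are the components of `Q` at the point `F x`. -/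
def TakesTo (F : Phase → Phase) (P Q : BivectorField) (U : Set Phase) : Prop :=
  ∀ x ∈ U, ∀ i j, bracket P (fun y => F y i) (fun y => F y j) x = Q (F x) i j

/-- `F` is a smooth diffeomorphism of the open set `U` onto the open set `W`. -/
def IsDiffeoOn (F : Phase → Phase) (U W : Set Phase) : Prop :=
  ∃ e : OpenPartialHomeomorph Phase Phase, e.source = U ∧ e.target = W ∧
    (∀ x ∈ U, e x = F x) ∧ ContDiffOn ℝ ∞ e U ∧ ContDiffOn ℝ ∞ e.symm W

/-! ### The bivectors -/

/-- The skew-symmetric matrix with entries `∑ₖ εᵢⱼₖ vₖ`. -/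
def skew (v : Fin 3 → ℝ) : Matrix (Fin 3) (Fin 3) ℝ :=
  !![0, v 2, -v 1; -v 2, 0, v 0; v 1, -v 0, 0]

/-- The bivector with `γM`-block `G` and `MM`-block `N`. -/
def blockBivector (G N : Matrix (Fin 3) (Fin 3) ℝ) :
    Matrix (Fin 3 ⊕ Fin 3) (Fin 3 ⊕ Fin 3) ℝ :=
  Matrix.fromBlocks 0 G (-Gᵀ) N

/-- The canonical Lie-Poisson bivector of `e*(3)`. -/
def canonicalP : BivectorField := fun x => blockBivector (skew (gam x)) (skew (mom x))

/-- The diagonal entries `a i = 1 / (I i + d)` of `𝐀 = (𝐈 + d 𝐄)⁻¹`. -/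
def aCoef (I : Fin 3 → ℝ) (d : ℝ) (i : Fin 3) : ℝ := 1 / (I i + d)

/-- The diagonal entries of `𝐁 = tr 𝐀⁻¹ + (κ - 1) 𝐀⁻¹` for `κ = -1`. -/
def bCoef (I : Fin 3 → ℝ) (d : ℝ) (i : Fin 3) : ℝ := (∑ j, (I j + d)) - 2 * (I i + d)

/-- The square `1 - d (γ, 𝐀 γ)` of the function `g`. -/
def gSq (I : Fin 3 → ℝ) (d : ℝ) (γ : Fin 3 → ℝ) : ℝ := 1 - d * ∑ i, aCoef I d i * γ i ^ 2

/-- The function `g = √(1 - d (γ, 𝐀 γ))`. -/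
def g (I : Fin 3 → ℝ) (d : ℝ) (γ : Fin 3 → ℝ) : ℝ := √(gSq I d γ)

/-- The part of the phase space on which `g` is real, smooth and nonzero. -/
def regularSet (I : Fin 3 → ℝ) (d : ℝ) : Set Phase := {x | 0 < gSq I d (gam x)}

/-- The bivector `P_g` of the Chaplygin sphere (`κ = 1`). -/
def Pg (I : Fin 3 → ℝ) (d : ℝ) : BivectorField := fun x =>
  g I d (gam x) • blockBivector (skew (gam x)) (skew (mom x))
    - (d * (g I d (gam x))⁻¹ * ∑ i, mom x i * (aCoef I d i * gam x i)) •
      blockBivector 0 (skew (gam x))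

/-- The function `C₂ = (γ, 𝐁 M)`. -/
def C2 (I : Fin 3 → ℝ) (d : ℝ) (x : Phase) : ℝ := ∑ i, gam x i * (bCoef I d i * mom x i)

/-- The functions `αₖ = C₂ + bₖ (γ, M)` that enter `P_b`. -/
def alphaP (I : Fin 3 → ℝ) (d : ℝ) (x : Phase) (k : Fin 3) : ℝ :=
  C2 I d x + bCoef I d k * (gam x ⬝ᵥ mom x)

/-- `((γ, γ) 𝐄 - 𝐂 - 𝐁 / (2 d)) Γ_b`, with `𝐂 = γ γᵀ` and `(Γ_b)ᵢⱼ = εᵢⱼₖ bₖ γₖ`. -/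
def hatGamma (I : Fin 3 → ℝ) (d : ℝ) (x : Phase) : Matrix (Fin 3) (Fin 3) ℝ :=
  ((gam x ⬝ᵥ gam x) • (1 : Matrix (Fin 3) (Fin 3) ℝ) - Matrix.vecMulVec (gam x) (gam x)
    - (1 / (2 * d)) • Matrix.diagonal (bCoef I d)) * skew (fun k => bCoef I d k * gam x k)

/-- The matrix `-εᵢⱼₖ (αₖ γₖ - (γ, γ) bₖ Mₖ + bₖ² Mₖ / (2 d))`. -/
def hatM (I : Fin 3 → ℝ) (d : ℝ) (x : Phase) : Matrix (Fin 3) (Fin 3) ℝ :=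
  -skew (fun k => alphaP I d x k * gam x k - (gam x ⬝ᵥ gam x) * bCoef I d k * mom x k
    + bCoef I d k ^ 2 * mom x k / (2 * d))

/-- The matrix `-εᵢⱼₖ bₖ γₖ ((bᵢ + bⱼ) αₖ + (bₖ - bᵢ) (bₖ - bⱼ) Mₖ γₖ) /
((b₁ + b₂) (b₂ + b₃) (b₁ + b₃))`. For a given `k` the other two indices are `k + 1` and
`k + 2` modulo `3`. -/
def tildeGamma (I : Fin 3 → ℝ) (d : ℝ) (x : Phase) : Matrix (Fin 3) (Fin 3) ℝ :=
  -skew (fun k => bCoef I d k * gam x k /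
      ((bCoef I d 0 + bCoef I d 1) * (bCoef I d 1 + bCoef I d 2) * (bCoef I d 0 + bCoef I d 2))
    * ((bCoef I d (k + 1) + bCoef I d (k + 2)) * alphaP I d x k
      + (bCoef I d k - bCoef I d (k + 1)) * (bCoef I d k - bCoef I d (k + 2))
        * mom x k * gam x k))

/-- The bivector `P_b` of the generalized Chaplygin sphere (`κ = -1`). -/
def Pb (I : Fin 3 → ℝ) (d : ℝ) : BivectorField := fun x =>
  g I d (gam x) • blockBivector (hatGamma I d x) (hatM I d x)
    + ((g I d (gam x))⁻¹ * (2 * d * (gam x ⬝ᵥ gam x) - ∑ i, bCoef I d i)) •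
      blockBivector 0 (tildeGamma I d x)

/-! ### The change of variables -/

/-- `s = 4 d² (γ, γ) (γ, 𝐁 γ) - 2 d ((𝐄 tr 𝐁 - 𝐁) γ, 𝐁 γ) + det 𝐁`. -/
def sFun (I : Fin 3 → ℝ) (d : ℝ) (γ : Fin 3 → ℝ) : ℝ :=
  4 * d ^ 2 * (γ ⬝ᵥ γ) * (∑ i, γ i * (bCoef I d i * γ i))
    - 2 * d * (∑ i, ((∑ j, bCoef I d j) - bCoef I d i) * γ i * (bCoef I d i * γ i))
    + bCoef I d 0 * bCoef I d 1 * bCoef I d 2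

/-- The coefficients `α₁, α₂, α₃` of the change of variables. -/
def alphaL (I : Fin 3 → ℝ) (d : ℝ) (γ : Fin 3 → ℝ) : Fin 3 → ℝ :=
  let b := bCoef I d
  ![2 * d * γ 1 * (2 * d * b 0 * γ 0 ^ 2 + 2 * d * b 1 * (γ 1 ^ 2 + γ 2 ^ 2) - b 0 * b 1),
    -2 * d * γ 0 * (2 * d * b 0 * (γ 0 ^ 2 + γ 2 ^ 2) + 2 * d * b 1 * γ 1 ^ 2 - b 0 * b 1),
    4 * d ^ 2 * γ 0 * γ 1 * γ 2 * (b 0 - b 1)]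

/-- The coefficients `β₁, β₂, β₃` of the change of variables. -/
def betaL (I : Fin 3 → ℝ) (d : ℝ) (γ : Fin 3 → ℝ) : Fin 3 → ℝ :=
  let b := bCoef I d
  ![-2 * d * γ 0 * γ 2 *
      (2 * d * (γ 1 ^ 2 * (b 0 * b 1 - b 0 * b 2 + b 1 * b 2)
        + b 1 * (b 0 * γ 0 ^ 2 + b 2 * γ 2 ^ 2)) - b 0 * b 1 * b 2),
    -2 * d * γ 1 * γ 2 *
      (2 * d * (γ 0 ^ 2 * (b 0 * b 2 + b 0 * b 1 - b 1 * b 2)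
        + b 0 * (b 1 * γ 1 ^ 2 + b 2 * γ 2 ^ 2)) - b 0 * b 1 * b 2),
    4 * d ^ 2 * b 2 * γ 2 ^ 2 * (b 1 * γ 0 ^ 2 + b 0 * γ 1 ^ 2)
      + 2 * d * b 0 * b 1 * (γ 0 ^ 2 + γ 1 ^ 2) * (2 * d * (γ 0 ^ 2 + γ 1 ^ 2) - b 2)]

/-- The new momenta `L₁, L₂, L₃` as functions of `(γ, M)`, for a function `h` of `γ` and a
value `c` (which is then equal to `(γ, L)`). -/
def newMom (I : Fin 3 → ℝ) (d : ℝ) (h : (Fin 3 → ℝ) → ℝ) (c : ℝ) (x : Phase) : Fin 3 → ℝ :=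
  let b := bCoef I d
  let γ := gam x
  let M := mom x
  let ρ := γ 0 ^ 2 + γ 1 ^ 2
  let N := 1 / (g I d γ * sFun I d γ * b 0 * b 1 * ρ)
  let m := b 0 * γ 1 * M 0 - b 1 * γ 0 * M 1
  ![N * (alphaL I d γ 0 * m + betaL I d γ 0 * M 2 + C2 I d x * γ 0 * γ 2 * h γ / ρ)
      + c * γ 0 / ρ,
    N * (alphaL I d γ 1 * m + betaL I d γ 1 * M 2 + C2 I d x * γ 1 * γ 2 * h γ / ρ)
      + c * γ 1 / ρ,
    N * (alphaL I d γ 2 * m + betaL I d γ 2 * M 2 - C2 I d x * h γ)]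

/-- The change of variables `(γ, M) ↦ (γ, L)`, in which `c` is a function `φ` of `(γ, γ)` and of
`C₂ = (γ, 𝐁 M)`. -/
def changeOfVariables (I : Fin 3 → ℝ) (d : ℝ) (h : (Fin 3 → ℝ) → ℝ) (φ : ℝ → ℝ → ℝ)
    (x : Phase) : Phase :=
  Sum.elim (gam x) (newMom I d h (φ (gam x ⬝ᵥ gam x) (C2 I d x)) x)

/-- The set of all `γ` for which the denominators in the change of variables are real and
nonzero. -/
def goodGamma (I : Fin 3 → ℝ) (d : ℝ) : Set (Fin 3 → ℝ) :=
  {γ | 0 < gSq I d γ ∧ sFun I d γ ≠ 0 ∧ γ 0 ^ 2 + γ 1 ^ 2 ≠ 0}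

/-- The open half great circle (meridian) through `γ` on the sphere of radius `|γ|`, from pole to
pole of the third axis. -/
def meridian (γ : Fin 3 → ℝ) : Set (Fin 3 → ℝ) :=
  {δ | δ ⬝ᵥ δ = γ ⬝ᵥ γ ∧ δ 0 * γ 1 = δ 1 * γ 0 ∧ 0 < δ 0 * γ 0 + δ 1 * γ 1}

end ChaplyginSphere

end

open ChaplyginSphere

/-!
Everything rests on a structural description of `P_b`. With the symmetric matrix
`𝐒 = 𝐁 - 2d (γ, γ) 𝐄 + 2d γ γᵀ`, for which `det 𝐒 = s` and `𝐒 γ = 𝐁 γ`, one has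
`Γ̂ = -(1 / 2d) Γ adj 𝐒`, and the brackets `{Mᵢ, Mⱼ}_b` are the components of the vector
`-(1 / 2d) (g 𝐒 𝐁 M + (𝐒 M, ∇g) 𝐁 γ)` (`Pb_eq_adjBivector`). In this form `g` may be replaced by
any function of `γ`: the Jacobi identity (`schouten_adjBivector`) only uses that `∇g` is a gradient.
In the same way `P_g` is compatible with `P` whatever the function `g` is.

*Incompatibility and nontriviality.* Multiplied by `g`, a suitable component of `[P, P_b]` is a
polynomial in `γ`. If it vanished on an open set it would vanish identically, but on a coordinate
axis it is a nonzero multiple of `(bₖ - bᵢ) (bₖ - bⱼ)`, for an index `k` at which `Iₖ` differs from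
the other two moments. Since `[P, L_Y P] = 0` for every `Y`, the bivector `P_b` is not a coboundary
either.

*Change of variables.* The functions `(γ, γ)` and `C₂` are Casimir functions of `P_b`. The
functions `μ = 𝐒 M` generate rotations of `γ` up to a factor: `{f μᵢ, γⱼ}_b = εᵢⱼₖ γₖ` for
`f = -2d / (g s)`, and `(γ, μ) = C₂`. The brackets of the `f μᵢ` with each other are those of
`so(3)` up to an error `C₂ (-∇f + 4d f (tr adj 𝐒 / s) γ)`. Here a shift
`L = f μ + C₂ θ(γ) + c η(γ)` by multiples of Casimir functions corrects the error, provided that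
`(γ, θ) = -f`, `(γ, η) = const`, `div θ = -4d f tr (adj 𝐒) / s` and `div η = 0`
(`IsNormalForm.bracket_shiftedMom_shiftedMom`). The momenta of the theorem are of this form
(`newMom_eq`): `η = (γ₁, γ₂, 0) / ρ`, and `θ` is explicit up to the term `K w` with
`K = h / (g s b₁ b₂ ρ)` and `w = (γ₁ γ₃ / ρ, γ₂ γ₃ / ρ, -1)`. As `w` is divergence free and tangent
to the meridians, the condition on `div θ` prescribes the derivative of `K` along meridians. In the
coordinates (equatorial point, tangent of latitude) the set `V` has intervals as fibres, and `K` is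
obtained by integration from a smooth section (`exists_meridian_antideriv`).

*Diffeomorphism.* The inverse is explicit: `c = (γ, L)`, then `C₂` from `c = φ((γ, γ), C₂)`, then
`M = -(g / 2d) adj 𝐒 (L - C₂ θ - c η)`.
-/

noncomputable section

namespace ChaplyginSphere

/-! ### Partial derivatives and the Schouten bracket -/

section PartialDerivatives

variable {f g : Phase → ℝ} {x : Phase} (l : Fin 3 ⊕ Fin 3)

theorem pd_const (c : ℝ) : pd (fun _ => c) l x = 0 := by simp [pd]

theorem pd_coord (i : Fin 3 ⊕ Fin 3) : pd (fun y => y i) l x = if i = l then 1 else 0 := by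
  have h : HasFDerivAt (fun y : Phase => y i)
      (ContinuousLinearMap.proj (R := ℝ) (φ := fun _ : Fin 3 ⊕ Fin 3 => ℝ) i) x :=
    hasFDerivAt_apply i x
  simp [pd, h.fderiv, Pi.single_apply]

theorem pd_add (hf : DifferentiableAt ℝ f x) (hg : DifferentiableAt ℝ g x) :
    pd (fun y => f y + g y) l x = pd f l x + pd g l x := by
  simp [pd, fderiv_fun_add hf hg]

theorem pd_sub (hf : DifferentiableAt ℝ f x) (hg : DifferentiableAt ℝ g x) :
    pd (fun y => f y - g y) l x = pd f l x - pd g l x := by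
  simp [pd, fderiv_fun_sub hf hg]

theorem pd_neg : pd (fun y => -f y) l x = -pd f l x := by
  simp [pd, fderiv_fun_neg]

theorem pd_mul (hf : DifferentiableAt ℝ f x) (hg : DifferentiableAt ℝ g x) :
    pd (fun y => f y * g y) l x = f x * pd g l x + g x * pd f l x := by
  simp [pd, fderiv_fun_mul hf hg]

theorem pd_pow (n : ℕ) (hf : DifferentiableAt ℝ f x) :
    pd (fun y => f y ^ n) l x = n * f x ^ (n - 1) * pd f l x := by
  simp [pd, fderiv_fun_pow n hf]

theorem pd_inv (hf : DifferentiableAt ℝ f x) (h : f x ≠ 0) :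
    pd (fun y => (f y)⁻¹) l x = -(f x ^ 2)⁻¹ * pd f l x := by
  have h1 := (hasDerivAt_inv h).comp_hasFDerivAt x hf.hasFDerivAt
  have h2 : HasFDerivAt (fun y => (f y)⁻¹) (-(f x ^ 2)⁻¹ • fderiv ℝ f x) x := h1
  simp [pd, h2.fderiv]

end PartialDerivatives

theorem schouten_cyclic (P Q : BivectorField) (x : Phase) (i j k : Fin 3 ⊕ Fin 3) :
    schouten P Q x j k i = schouten P Q x i j k := by
  unfold schouten
  exact Finset.sum_congr rfl fun l _ => by ring

theorem schouten_swap {P Q : BivectorField} (hP : ∀ x i j, P x j i = -P x i j)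
    (hQ : ∀ x i j, Q x j i = -Q x i j) (x : Phase) (i j k : Fin 3 ⊕ Fin 3) :
    schouten P Q x j i k = -schouten P Q x i j k := by
  unfold schouten
  rw [← Finset.sum_neg_distrib]
  refine Finset.sum_congr rfl fun l _ => ?_
  have e : ∀ R : BivectorField, (∀ x i j, R x j i = -R x i j) → ∀ a b,
      pd (fun y => R y b a) l x = -pd (fun y => R y a b) l x := by
    intro R hR a b
    rw [← pd_neg]
    congr 1
    ext y
    exact hR y a b
  rw [e P hP k i, e P hP j k, e P hP i j, e Q hQ k i, e Q hQ j k, e Q hQ i j]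
  ring

/-- By antisymmetry the Schouten bracket vanishes as soon as its components with increasing
indices do. -/
theorem schouten_eq_zero_of_sorted {P Q : BivectorField} (hP : ∀ x i j, P x j i = -P x i j)
    (hQ : ∀ x i j, Q x j i = -Q x i j) (x : Phase)
    (h0 : ∀ i j k : Fin 3, schouten P Q x (.inl i) (.inl j) (.inl k) = 0)
    (h1 : ∀ i j k : Fin 3, schouten P Q x (.inl i) (.inl j) (.inr k) = 0)
    (h2 : ∀ i k : Fin 3, schouten P Q x (.inl i) (.inr (k + 1)) (.inr (k + 2)) = 0)
    (h3 : schouten P Q x (.inr 0) (.inr 1) (.inr 2) = 0) (i j k : Fin 3 ⊕ Fin 3) :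
    schouten P Q x i j k = 0 := by
  have cyc := schouten_cyclic P Q x
  have sw := schouten_swap hP hQ x
  generalize schouten P Q x = C at *
  have sw' : ∀ i j k, C i j k = 0 → C j i k = 0 := by
    intro i j k h; rw [sw, h, neg_zero]
  have dg : ∀ j k, C j j k = 0 := by
    intro j k
    have := sw j j k
    linarith
  have h2' : ∀ i j k : Fin 3, C (.inl i) (.inr j) (.inr k) = 0 := by
    intro i j k
    have a0 := h2 i 0
    have a1 := h2 i 1
    have a2 := h2 i 2
    simp only [zero_add, Fin.isValue, show (1 : Fin 3) + 1 = 2 from rfl,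
      show (1 : Fin 3) + 2 = 0 from rfl, show (2 : Fin 3) + 1 = 0 from rfl,
      show (2 : Fin 3) + 2 = 1 from rfl] at a0 a1 a2
    rw [← cyc] at a0 a1 a2 ⊢
    fin_cases j <;> fin_cases k <;>
      first
        | exact dg _ _
        | exact a0
        | exact a1
        | exact a2
        | exact sw' _ _ _ a0
        | exact sw' _ _ _ a1
        | exact sw' _ _ _ a2
  have h3' : ∀ i j k : Fin 3, C (.inr i) (.inr j) (.inr k) = 0 := by
    intro i j k
    have b1 := h3
    have b2 := h3
    rw [← cyc] at b1
    rw [← cyc, ← cyc] at b2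
    fin_cases i <;> fin_cases j <;> fin_cases k <;>
      first
        | exact dg _ _
        | exact h3
        | exact b1
        | exact b2
        | exact sw' _ _ _ h3
        | exact sw' _ _ _ b1
        | exact sw' _ _ _ b2
        | (rw [← cyc]; exact dg _ _)
        | (rw [cyc]; exact dg _ _)
  rcases i with i | i <;> rcases j with j | j <;> rcases k with k | k
  · exact h0 i j k
  · exact h1 i j k
  · rw [cyc]; exact h1 k i j
  · exact h2' i j k
  · rw [← cyc]; exact h1 j k i
  · rw [← cyc]; exact h2' j k i
  · rw [cyc]; exact h2' k i j
  · exact h3' i j k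

theorem skew_transpose (v : Fin 3 → ℝ) : (skew v)ᵀ = -skew v := by
  ext i j
  fin_cases i <;> fin_cases j <;> simp [skew]

theorem blockBivector_skew (G : Matrix (Fin 3) (Fin 3) ℝ) (v : Fin 3 → ℝ)
    (i j : Fin 3 ⊕ Fin 3) :
    blockBivector G (skew v) j i = -blockBivector G (skew v) i j := by
  have h : (skew v) = -(skew v)ᵀ := by rw [skew_transpose, neg_neg]
  rcases i with i | i <;> rcases j with j | j <;> simp [blockBivector]
  exact congrFun (congrFun h j) i

/-! ### The structure of the bivector `P_b` -/

/-- The symmetric matrix `𝐒 = 𝐁 - 2 d (γ, γ) 𝐄 + 2 d γ γᵀ`. Its determinant is `s` and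
it satisfies `𝐒 γ = 𝐁 γ`. -/
def symS (b : Fin 3 → ℝ) (d : ℝ) (γ : Fin 3 → ℝ) : Matrix (Fin 3) (Fin 3) ℝ :=
  !![b 0 - 2 * d * (γ 1 ^ 2 + γ 2 ^ 2), 2 * d * (γ 0 * γ 1), 2 * d * (γ 0 * γ 2);
     2 * d * (γ 0 * γ 1), b 1 - 2 * d * (γ 0 ^ 2 + γ 2 ^ 2), 2 * d * (γ 1 * γ 2);
     2 * d * (γ 0 * γ 2), 2 * d * (γ 1 * γ 2), b 2 - 2 * d * (γ 0 ^ 2 + γ 1 ^ 2)]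

/-- The adjugate matrix of `symS`. -/
def adjS (b : Fin 3 → ℝ) (d : ℝ) (γ : Fin 3 → ℝ) : Matrix (Fin 3) (Fin 3) ℝ :=
  (symS b d γ).adjugate

/-- The bivector with `{γᵢ, Mⱼ} = -(u / 2d) (Γ adj 𝐒)ᵢⱼ` and
`{Mᵢ, Mⱼ} = -(1 / 2d) εᵢⱼₖ (u 𝐒 𝐁 M + (𝐒 M, p) 𝐁 γ)ₖ`. It is a Poisson bivector for every
function `u` of `γ` with gradient `p`. Both are encoded as functions on the phase space, and
`p` is kept separate from `u`: that it is the gradient is a hypothesis (`IsGammaPotentialAt`)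
where it matters. -/
def adjBivector (b : Fin 3 → ℝ) (d : ℝ) (u : Phase → ℝ) (p : Phase → Fin 3 → ℝ) :
    BivectorField := fun x =>
  blockBivector ((-1 / (2 * d) * u x) • (skew (gam x) * adjS b d (gam x)))
    (skew fun k => -1 / (2 * d) *
      (u x * (symS b d (gam x) *ᵥ fun i => b i * mom x i) k
        + ((symS b d (gam x) *ᵥ mom x) ⬝ᵥ p x) * (b k * gam x k)))

/-- The gradient of `g`, where `g` is positive. -/
def gradG (I : Fin 3 → ℝ) (d : ℝ) (γ : Fin 3 → ℝ) : Fin 3 → ℝ :=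
  fun i => -d * (g I d γ)⁻¹ * (aCoef I d i * γ i)

/-- The identity `g = g² / g`. It holds also where `g` vanishes or its radicand is negative, both
sides then being `0`. -/
theorem g_eq (I : Fin 3 → ℝ) (d : ℝ) (γ : Fin 3 → ℝ) : g I d γ = (g I d γ)⁻¹ * gSq I d γ := by
  unfold g
  rcases le_or_gt (gSq I d γ) 0 with h | h
  · simp [Real.sqrt_eq_zero_of_nonpos h]
  · have h1 : √(gSq I d γ) ≠ 0 := (Real.sqrt_pos.2 h).ne'
    field_simp
    exact Real.sq_sqrt h.le

/-- The structure of `P_b`. The product `(b₁ + b₂) (b₂ + b₃) (b₁ + b₃)` in the denominator of `P_b`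
is `8 / (a₁ a₂ a₃)`, since `bᵢ + bⱼ = 2 / aₖ`. -/
theorem Pb_eq_adjBivector {I : Fin 3 → ℝ} {d : ℝ} (hI : ∀ i, 0 < I i) (hd : 0 < d) :
    Pb I d = adjBivector (bCoef I d) d (fun x => g I d (gam x)) (fun x => gradG I d (gam x)) := by
  ext x i j
  have h0 := (add_pos (hI 0) hd).ne'
  have h1 := (add_pos (hI 1) hd).ne'
  have h2 := (add_pos (hI 2) hd).ne'
  have hg := g_eq I d (gam x)
  have hG : hatGamma I d x
      = (-1 / (2 * d)) • (skew (gam x) * adjS (bCoef I d) d (gam x)) := by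
    ext i j
    fin_cases i <;> fin_cases j <;>
      (simp [hatGamma, adjS, symS, skew, Matrix.mul_apply, Fin.sum_univ_three, Matrix.vecMulVec,
        Matrix.adjugate_fin_three, dotProduct]
       field_simp
       ring)
  have hs : ∀ k, (bCoef I d (k + 1) + bCoef I d (k + 2)) = 2 * (I k + d) := by
    intro k; fin_cases k <;> simp [bCoef, Fin.sum_univ_three] <;> ring
  have hM : g I d (gam x) • hatM I d x
      + ((g I d (gam x))⁻¹ * (2 * d * (gam x ⬝ᵥ gam x) - ∑ i, bCoef I d i)) • tildeGamma I d x
      = skew fun k => -1 / (2 * d) *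
        (g I d (gam x) * (symS (bCoef I d) d (gam x) *ᵥ fun i => bCoef I d i * mom x i) k
        + ((symS (bCoef I d) d (gam x) *ᵥ mom x) ⬝ᵥ gradG I d (gam x))
          * (bCoef I d k * gam x k)) := by
    have key : ∀ k, g I d (gam x) * (-(alphaP I d x k * gam x k
        - (gam x ⬝ᵥ gam x) * bCoef I d k * mom x k + bCoef I d k ^ 2 * mom x k / (2 * d)))
        + ((g I d (gam x))⁻¹ * (2 * d * (gam x ⬝ᵥ gam x) - ∑ i, bCoef I d i)) *
        (-(bCoef I d k * gam x k /
      ((bCoef I d 0 + bCoef I d 1) * (bCoef I d 1 + bCoef I d 2) * (bCoef I d 0 + bCoef I d 2))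
    * ((bCoef I d (k + 1) + bCoef I d (k + 2)) * alphaP I d x k
      + (bCoef I d k - bCoef I d (k + 1)) * (bCoef I d k - bCoef I d (k + 2))
        * mom x k * gam x k)))
        = -1 / (2 * d) *
        (g I d (gam x) * (symS (bCoef I d) d (gam x) *ᵥ fun i => bCoef I d i * mom x i) k
        + ((symS (bCoef I d) d (gam x) *ᵥ mom x) ⬝ᵥ gradG I d (gam x))
          * (bCoef I d k * gam x k)) := by
      intro k
      have t0 : bCoef I d 1 + bCoef I d 2 = 2 * (I 0 + d) := hs 0
      have t1 : bCoef I d 0 + bCoef I d 2 = 2 * (I 1 + d) := by rw [add_comm]; exact hs 1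
      have t2 : bCoef I d 0 + bCoef I d 1 = 2 * (I 2 + d) := hs 2
      rw [t0, t1, t2, hs k]
      have e1 : gradG I d (gam x)
          = fun i => -d * (g I d (gam x))⁻¹ * (aCoef I d i * gam x i) := rfl
      rw [e1]
      generalize (g I d (gam x))⁻¹ = gi at hg ⊢
      rw [hg]
      simp only [gSq, aCoef]
      fin_cases k <;>
      (simp [symS, alphaP, C2, Matrix.mulVec, dotProduct, Fin.sum_univ_three, bCoef]
       field_simp
       ring)
    ext i j
    fin_cases i <;> fin_cases j <;>
      simp [hatM, tildeGamma, skew, -mul_neg, -neg_mul] <;>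
    first
      | exact key _
      | (rw [← key]; simp; try ring)
  rcases i with i | i <;> rcases j with j | j
  · simp [Pb, adjBivector, blockBivector]
  · simp [Pb, adjBivector, blockBivector, hG]
    ring
  · simp [Pb, adjBivector, blockBivector, hG]
    ring
  · have := congrFun (congrFun hM i) j
    simpa [Pb, adjBivector, blockBivector] using this

theorem adjBivector_skew (b : Fin 3 → ℝ) (d : ℝ) (u : Phase → ℝ) (p : Phase → Fin 3 → ℝ)
    (x : Phase) (i j : Fin 3 ⊕ Fin 3) :
    adjBivector b d u p x j i = -adjBivector b d u p x i j :=
  blockBivector_skew _ _ _ _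

/-- Data of a function `u` of `γ` near the phase point `x`: `p` is its gradient, and the derivative
`H` of `p` is symmetric. -/
structure IsGammaPotentialAt (u : Phase → ℝ) (p : Phase → Fin 3 → ℝ)
    (H : Fin 3 → Fin 3 → ℝ) (x : Phase) : Prop where
  diff : DifferentiableAt ℝ u x
  diff_grad : ∀ i, DifferentiableAt ℝ (fun y => p y i) x
  pd_inl : ∀ l, pd u (.inl l) x = p x l
  pd_inr : ∀ l, pd u (.inr l) x = 0
  pd_grad_inl : ∀ i l, pd (fun y => p y i) (.inl l) x = H i l
  pd_grad_inr : ∀ i l, pd (fun y => p y i) (.inr l) x = 0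
  symm : ∀ i l, H i l = H l i

theorem pd_comp_gam_inr (F : (Fin 3 → ℝ) → ℝ) (l : Fin 3) (x : Phase) :
    pd (fun y => F (gam y)) (.inr l) x = 0 := by
  by_cases h : DifferentiableAt ℝ (fun y => F (gam y)) x
  · rw [pd, ← h.lineDeriv_eq_fderiv, lineDeriv]
    have e : ∀ t : ℝ, gam (x + t • Pi.single (Sum.inr l) 1) = gam x := by
      intro t; ext i; simp [gam]
    simp [e]
  · simp [pd, fderiv_zero_of_not_differentiableAt h]

theorem differentiable_gam : Differentiable ℝ gam := by
  unfold gam; fun_prop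

theorem differentiable_skew_mul_adjS (b : Fin 3 → ℝ) (d : ℝ) (j k : Fin 3) :
    Differentiable ℝ fun γ => (skew γ * adjS b d γ) j k := by
  fin_cases j <;> fin_cases k <;>
    (simp only [Matrix.mul_apply, skew, adjS, Matrix.adjugate_fin_three, symS, Matrix.of_apply,
      Matrix.cons_val, Fin.sum_univ_three, Fin.isValue, Fin.zero_eta, Fin.mk_one, Fin.reduceFinMk]
     fun_prop)

theorem schouten_self (P : BivectorField) (x : Phase) (i j k : Fin 3 ⊕ Fin 3) :
    schouten P P x i j k = 2 * ∑ l, (P x i l * pd (fun y => P y j k) l x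
      + P x j l * pd (fun y => P y k i) l x + P x k l * pd (fun y => P y i j) l x) := by
  rw [schouten, Finset.mul_sum]
  exact Finset.sum_congr rfl fun l _ => by ring

set_option linter.unusedSimpArgs false in
set_option maxHeartbeats 8000000 in
/-- The Jacobi identity for `adjBivector`, for every function `u` of `γ`. -/
theorem schouten_adjBivector (b : Fin 3 → ℝ) (d : ℝ) {u : Phase → ℝ} {p : Phase → Fin 3 → ℝ}
    {H : Fin 3 → Fin 3 → ℝ} {x : Phase} (h : IsGammaPotentialAt u p H x)
    (i j k : Fin 3 ⊕ Fin 3) :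
    schouten (adjBivector b d u p) (adjBivector b d u p) x i j k = 0 := by
  obtain ⟨hu, hp, hu1, hu2, hp1, hp2, hH⟩ := h
  have hq0 := hp 0
  have hq1 := hp 1
  have hq2 := hp 2
  have hG : ∀ j k l, pd (fun y => -1 / (2 * d) * u y * (skew (gam y) * adjS b d (gam y)) j k)
      (.inr l) x = 0 := by
    intro j k l
    have h1 : DifferentiableAt ℝ (fun y => (skew (gam y) * adjS b d (gam y)) j k) x :=
      ((differentiable_skew_mul_adjS b d j k).comp differentiable_gam).differentiableAt
    have h2 : pd (fun y => (skew (gam y) * adjS b d (gam y)) j k) (.inr l) x = 0 :=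
      pd_comp_gam_inr (fun γ => (skew γ * adjS b d γ) j k) l x
    rw [pd_mul _ (by fun_prop) h1, pd_mul _ (by fun_prop) (by fun_prop), hu2, pd_const, h2]
    ring
  refine schouten_eq_zero_of_sorted (adjBivector_skew b d u p) (adjBivector_skew b d u p) x
    ?_ ?_ ?_ ?_ i j k
  · intro i j k
    simp [schouten, adjBivector, blockBivector, pd_const]
  · intro i j k
    simp [schouten, adjBivector, blockBivector, pd_const, pd_neg, hG,
      -Matrix.transpose_mul]
  · unfold adjBivector
    generalize -1 / (2 * d) = c
    intro i k
    fin_cases i <;> fin_cases k <;>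
      (simp (disch := fun_prop) only [schouten_self, Fintype.sum_sum_type, Fin.sum_univ_three,
        blockBivector, Matrix.fromBlocks_apply₁₁, Matrix.fromBlocks_apply₁₂,
        Matrix.fromBlocks_apply₂₁, Matrix.fromBlocks_apply₂₂, Matrix.neg_apply,
        Matrix.transpose_apply, Matrix.smul_apply, Matrix.zero_apply, Matrix.mul_apply, skew, adjS,
        Matrix.adjugate_fin_three, symS, Matrix.of_apply, Matrix.cons_val, Matrix.mulVec,
        dotProduct, gam, mom, smul_eq_mul, pd_add, pd_sub, pd_mul, pd_neg, pd_pow, pd_const,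
        pd_coord, hu1, hu2, hp1, hp2, Sum.inl.injEq, Sum.inr.injEq, reduceCtorEq, if_true,
        if_false, Fin.isValue, zero_mul, mul_zero, add_zero, zero_add, mul_one, sub_zero, zero_sub,
        neg_zero, Fin.reduceEq, Fin.zero_eta, Fin.mk_one, Fin.reduceFinMk, Fin.reduceAdd,
        Nat.add_one_sub_one, pow_one]
       ring)
  · unfold adjBivector
    generalize -1 / (2 * d) = c
    simp (disch := fun_prop) only [schouten_self, Fintype.sum_sum_type, Fin.sum_univ_three,
        blockBivector, Matrix.fromBlocks_apply₁₁, Matrix.fromBlocks_apply₁₂,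
        Matrix.fromBlocks_apply₂₁, Matrix.fromBlocks_apply₂₂, Matrix.neg_apply,
        Matrix.transpose_apply, Matrix.smul_apply, Matrix.zero_apply, Matrix.mul_apply, skew, adjS,
        Matrix.adjugate_fin_three, symS, Matrix.of_apply, Matrix.cons_val, Matrix.mulVec,
        dotProduct, gam, mom, smul_eq_mul, pd_add, pd_sub, pd_mul, pd_neg, pd_pow, pd_const,
        pd_coord, hu1, hu2, hp1, hp2, Sum.inl.injEq, Sum.inr.injEq, reduceCtorEq, if_true,
        if_false, Fin.isValue, zero_mul, mul_zero, add_zero, zero_add, mul_one, sub_zero, zero_sub,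
        neg_zero, Fin.reduceEq, Fin.zero_eta, Fin.mk_one, Fin.reduceFinMk, Fin.reduceAdd,
        Nat.add_one_sub_one, pow_one]
    rw [hH 1 0, hH 2 0, hH 2 1]
    ring

theorem pd_sqrt {f : Phase → ℝ} {x : Phase} (l : Fin 3 ⊕ Fin 3) (hf : DifferentiableAt ℝ f x)
    (h : f x ≠ 0) : pd (fun y => √(f y)) l x = (√(f x))⁻¹ * (pd f l x / 2) := by
  have h1 : HasFDerivAt (fun y => √(f y)) ((1 / (2 * √(f x))) • fderiv ℝ f x) x :=
    (Real.hasDerivAt_sqrt h).comp_hasFDerivAt x hf.hasFDerivAt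
  simp only [pd, h1.fderiv, smul_apply, smul_eq_mul]
  ring

theorem differentiable_gSq (I : Fin 3 → ℝ) (d : ℝ) : Differentiable ℝ fun y => gSq I d (gam y) := by
  unfold gSq gam
  fun_prop

theorem differentiableAt_g {I : Fin 3 → ℝ} {d : ℝ} {x : Phase} (hx : x ∈ regularSet I d) :
    DifferentiableAt ℝ (fun y => g I d (gam y)) x :=
  (differentiable_gSq I d x).sqrt (ne_of_gt hx)

theorem g_pos {I : Fin 3 → ℝ} {d : ℝ} {γ : Fin 3 → ℝ} (hγ : 0 < gSq I d γ) : 0 < g I d γ :=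
  Real.sqrt_pos.2 hγ

theorem pd_g_inl {I : Fin 3 → ℝ} {d : ℝ} {x : Phase} (hx : x ∈ regularSet I d) (l : Fin 3) :
    pd (fun y => g I d (gam y)) (.inl l) x = gradG I d (gam x) l := by
  have h : pd (fun y => gSq I d (gam y)) (.inl l) x = -2 * d * (aCoef I d l * gam x l) := by
    fin_cases l <;>
      (simp (disch := fun_prop) [gSq, gam, Fin.sum_univ_three, pd_sub, pd_mul, pd_add, pd_pow,
        pd_const, pd_coord]
       ring)
  unfold g
  rw [pd_sqrt _ (differentiable_gSq I d x) (ne_of_gt hx), h]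
  simp only [gradG, g]
  ring

theorem isGammaPotentialAt_g {I : Fin 3 → ℝ} {d : ℝ} {x : Phase} (hx : x ∈ regularSet I d) :
    IsGammaPotentialAt (fun y => g I d (gam y)) (fun y => gradG I d (gam y))
      (fun i l => -d * aCoef I d i * (if i = l then (g I d (gam x))⁻¹ else 0)
        - d ^ 2 * (g I d (gam x))⁻¹ ^ 3 * (aCoef I d i * gam x i) * (aCoef I d l * gam x l)) x := by
  have hg := differentiableAt_g hx
  have hne : g I d (gam x) ≠ 0 := (g_pos hx).ne'
  have hgi : DifferentiableAt ℝ (fun y => (g I d (gam y))⁻¹) x := hg.inv hne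
  have hγ : ∀ i, DifferentiableAt ℝ (fun y => gam y i) x := fun i => by unfold gam; fun_prop
  have hγ1 : ∀ i l, pd (fun y => gam y i) l x = if Sum.inl i = l then 1 else 0 :=
    fun i l => pd_coord l (.inl i)
  refine ⟨hg, fun i => ?_, pd_g_inl hx, fun l => pd_comp_gam_inr _ l x, fun i l => ?_,
    fun i l => pd_comp_gam_inr (fun γ => gradG I d γ i) l x, fun i l => ?_⟩
  · unfold gradG
    fun_prop
  · unfold gradG
    rw [pd_mul _ (by fun_prop) (by fun_prop), pd_mul _ (by fun_prop) (by fun_prop),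
      pd_mul _ (by fun_prop) (by fun_prop), pd_const, pd_const, pd_inv _ hg hne, pd_g_inl hx, hγ1]
    simp only [gradG, Sum.inl.injEq]
    split_ifs <;> ring
  · rcases eq_or_ne i l with rfl | h
    · rfl
    · simp [h, h.symm]; ring

theorem contDiff_gam : ContDiff ℝ ∞ gam := by
  unfold gam
  fun_prop

theorem contDiff_gSq (I : Fin 3 → ℝ) (d : ℝ) : ContDiff ℝ ∞ (gSq I d) := by
  unfold gSq
  fun_prop

theorem contDiffOn_g (I : Fin 3 → ℝ) (d : ℝ) : ContDiffOn ℝ ∞ (g I d) {γ | 0 < gSq I d γ} :=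
  (contDiff_gSq I d).contDiffOn.sqrt fun _ h => ne_of_gt h

theorem contDiff_symS (b : Fin 3 → ℝ) (d : ℝ) (i j : Fin 3) :
    ContDiff ℝ ∞ fun γ => symS b d γ i j := by
  fin_cases i <;> fin_cases j <;> simp [symS] <;> fun_prop

theorem contDiff_adjS (b : Fin 3 → ℝ) (d : ℝ) (i j : Fin 3) :
    ContDiff ℝ ∞ fun γ => adjS b d γ i j := by
  have h := contDiff_symS b d
  fin_cases i <;> fin_cases j <;> simp [adjS, Matrix.adjugate_fin_three] <;> fun_prop

theorem contDiffOn_skew {v : Phase → Fin 3 → ℝ} {U : Set Phase}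
    (hv : ∀ k, ContDiffOn ℝ ∞ (fun x => v x k) U) (i j : Fin 3) :
    ContDiffOn ℝ ∞ (fun x => skew (v x) i j) U := by
  have hn := fun k => (hv k).neg
  fin_cases i <;> fin_cases j <;> simp [skew] <;>
    first
      | exact contDiffOn_const
      | exact hv _
      | exact hn _

theorem contDiffOn_adjBivector (b : Fin 3 → ℝ) (d : ℝ) {u : Phase → ℝ} {p : Phase → Fin 3 → ℝ}
    {U : Set Phase} (hu : ContDiffOn ℝ ∞ u U) (hp : ∀ i, ContDiffOn ℝ ∞ (fun x => p x i) U)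
    (i j : Fin 3 ⊕ Fin 3) : ContDiffOn ℝ ∞ (fun x => adjBivector b d u p x i j) U := by
  have hS : ∀ i j, ContDiffOn ℝ ∞ (fun x => symS b d (gam x) i j) U := fun i j =>
    ((contDiff_symS b d i j).comp contDiff_gam).contDiffOn
  have hA : ∀ i j, ContDiffOn ℝ ∞ (fun x => adjS b d (gam x) i j) U := fun i j =>
    ((contDiff_adjS b d i j).comp contDiff_gam).contDiffOn
  have hγ : ∀ i, ContDiffOn ℝ ∞ (fun x => gam x i) U := fun i => by unfold gam; fun_prop
  have hM : ∀ i, ContDiffOn ℝ ∞ (fun x => mom x i) U := fun i => by unfold mom; fun_prop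
  have hG : ∀ i j, ContDiffOn ℝ ∞
      (fun x => -1 / (2 * d) * u x * (skew (gam x) * adjS b d (gam x)) i j) U := by
    intro i j
    have hk := contDiffOn_skew hγ
    simp only [Matrix.mul_apply]
    fun_prop
  rcases i with i | i <;> rcases j with j | j
  · simpa [adjBivector, blockBivector] using contDiffOn_const
  · simpa [adjBivector, blockBivector] using hG i j
  · simpa [adjBivector, blockBivector, -Matrix.transpose_mul] using (hG j i).neg
  · simp only [adjBivector, blockBivector, Matrix.fromBlocks_apply₂₂]
    refine contDiffOn_skew (fun k => ?_) i j
    simp only [Matrix.mulVec, dotProduct]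
    fun_prop

theorem contDiffOn_gradG (I : Fin 3 → ℝ) (d : ℝ) (i : Fin 3) :
    ContDiffOn ℝ ∞ (fun γ => gradG I d γ i) {γ | 0 < gSq I d γ} := by
  have h : ContDiffOn ℝ ∞ (fun γ => (g I d γ)⁻¹) {γ | 0 < gSq I d γ} :=
    (contDiffOn_g I d).inv fun γ hγ => (g_pos hγ).ne'
  unfold gradG
  fun_prop

theorem isPoissonOn_Pb {I : Fin 3 → ℝ} {d : ℝ} (hI : ∀ i, 0 < I i) (hd : 0 < d) :
    IsPoissonOn (Pb I d) (regularSet I d) := by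
  rw [Pb_eq_adjBivector hI hd]
  refine ⟨contDiffOn_adjBivector _ _ ?_ fun i => ?_, fun x _ i j => adjBivector_skew _ _ _ _ x i j,
    fun x hx => schouten_adjBivector _ _ (isGammaPotentialAt_g hx)⟩
  · exact (contDiffOn_g I d).comp contDiff_gam.contDiffOn fun x hx => hx
  · exact (contDiffOn_gradG I d i).comp contDiff_gam.contDiffOn fun x hx => hx

/-! ### Compatibility of `P_g` with the canonical bivector -/

/-- The bivector with `{γᵢ, Mⱼ} = εᵢⱼₖ u γₖ` and `{Mᵢ, Mⱼ} = εᵢⱼₖ (u M + (M, p) γ)ₖ`. It is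
compatible with the canonical one for every function `u` of `γ` with gradient `p`. -/
def gradBivector (u : Phase → ℝ) (p : Phase → Fin 3 → ℝ) : BivectorField := fun x =>
  blockBivector (u x • skew (gam x))
    (skew fun k => u x * mom x k + (mom x ⬝ᵥ p x) * gam x k)

theorem Pg_eq_gradBivector (I : Fin 3 → ℝ) (d : ℝ) :
    Pg I d = gradBivector (fun x => g I d (gam x)) (fun x => gradG I d (gam x)) := by
  ext x i j
  rcases i with i | i <;> rcases j with j | j
  · simp [Pg, gradBivector, blockBivector]
  · simp [Pg, gradBivector, blockBivector]
  · simp [Pg, gradBivector, blockBivector]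
  · have e : d * (g I d (gam x))⁻¹ * ∑ i, mom x i * (aCoef I d i * gam x i)
        = -(mom x ⬝ᵥ gradG I d (gam x)) := by
      simp only [dotProduct, gradG, Fin.sum_univ_three]
      ring
    simp only [Pg, gradBivector, blockBivector, e]
    fin_cases i <;> fin_cases j <;> simp [skew] <;> ring

set_option linter.unusedSimpArgs false in
set_option maxHeartbeats 2000000 in
theorem schouten_canonicalP_gradBivector {u : Phase → ℝ} {p : Phase → Fin 3 → ℝ}
    {H : Fin 3 → Fin 3 → ℝ} {x : Phase} (h : IsGammaPotentialAt u p H x)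
    (i j k : Fin 3 ⊕ Fin 3) :
    schouten canonicalP (gradBivector u p) x i j k = 0 := by
  obtain ⟨hu, hp, hu1, hu2, hp1, hp2, hH⟩ := h
  have hq0 := hp 0
  have hq1 := hp 1
  have hq2 := hp 2
  have hs : ∀ j k l, pd (fun y => skew (gam y) j k) (.inr l) x = 0 := fun j k l =>
    pd_comp_gam_inr (fun γ => skew γ j k) l x
  have hG : ∀ j k l, pd (fun y => u y * skew (gam y) j k) (.inr l) x = 0 := by
    intro j k l
    have h1 : DifferentiableAt ℝ (fun y => skew (gam y) j k) x := by
      fin_cases j <;> fin_cases k <;> simp [skew, gam] <;> fun_prop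
    rw [pd_mul _ hu h1, hu2, hs]
    ring
  refine schouten_eq_zero_of_sorted (fun x => blockBivector_skew _ _)
    (fun x => blockBivector_skew _ _) x ?_ ?_ ?_ ?_ i j k
  · intro i j k
    simp [schouten, gradBivector, canonicalP, blockBivector, pd_const]
  · intro i j k
    simp [schouten, gradBivector, canonicalP, blockBivector, pd_const, pd_neg, hG, hs]
  · intro i k
    fin_cases i <;> fin_cases k <;>
      (simp (disch := fun_prop) only [schouten, Fintype.sum_sum_type, Fin.sum_univ_three,
        canonicalP, gradBivector, blockBivector, Matrix.fromBlocks_apply₁₁,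
        Matrix.fromBlocks_apply₁₂, Matrix.fromBlocks_apply₂₁, Matrix.fromBlocks_apply₂₂,
        Matrix.neg_apply, Matrix.transpose_apply, Matrix.smul_apply, Matrix.zero_apply, skew,
        Matrix.of_apply, Matrix.cons_val, dotProduct, gam, mom, smul_eq_mul, pd_add, pd_sub,
        pd_mul, pd_neg, pd_const, pd_coord, hu1, hu2, hp1, hp2, Sum.inl.injEq, Sum.inr.injEq,
        reduceCtorEq, if_true, if_false, Fin.isValue, zero_mul, mul_zero, add_zero, zero_add,
        mul_one, sub_zero, zero_sub, neg_zero, Fin.reduceEq, Fin.zero_eta, Fin.mk_one,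
        Fin.reduceFinMk, Fin.reduceAdd]
       ring)
  · simp (disch := fun_prop) only [schouten, Fintype.sum_sum_type, Fin.sum_univ_three,
      canonicalP, gradBivector, blockBivector, Matrix.fromBlocks_apply₁₁,
      Matrix.fromBlocks_apply₁₂, Matrix.fromBlocks_apply₂₁, Matrix.fromBlocks_apply₂₂,
      Matrix.neg_apply, Matrix.transpose_apply, Matrix.smul_apply, Matrix.zero_apply, skew,
      Matrix.of_apply, Matrix.cons_val, dotProduct, gam, mom, smul_eq_mul, pd_add, pd_sub,
      pd_mul, pd_neg, pd_const, pd_coord, hu1, hu2, hp1, hp2, Sum.inl.injEq, Sum.inr.injEq,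
      reduceCtorEq, if_true, if_false, Fin.isValue, zero_mul, mul_zero, add_zero, zero_add,
      mul_one, sub_zero, zero_sub, neg_zero, Fin.reduceEq]
    rw [hH 1 0, hH 2 0, hH 2 1]
    ring

theorem compatibleOn_Pg (I : Fin 3 → ℝ) (d : ℝ) :
    CompatibleOn canonicalP (Pg I d) (regularSet I d) := by
  rw [Pg_eq_gradBivector]
  exact fun x hx => schouten_canonicalP_gradBivector (isGammaPotentialAt_g hx)

/-! ### `P_b` is neither compatible with the canonical bivector nor a trivial deformation of it -/

set_option linter.unusedSimpArgs false in
set_option maxHeartbeats 2000000 in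
/-- A component of the Schouten bracket of the canonical bivector with `adjBivector`. It does not
depend on `M`, and for `u = g` its part of lowest degree in `γ` is a multiple of
`(bₖ - bᵢ) (bₖ - bⱼ) γⱼ`, where `i = k + 1` and `j = k + 2`. -/
theorem schouten_canonicalP_adjBivector (b : Fin 3 → ℝ) (d : ℝ) {u : Phase → ℝ}
    {p : Phase → Fin 3 → ℝ} {H : Fin 3 → Fin 3 → ℝ} {x : Phase}
    (h : IsGammaPotentialAt u p H x) (k : Fin 3) :
    schouten canonicalP (adjBivector b d u p) x (.inl (k + 1)) (.inr (k + 1)) (.inr (k + 2))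
      = -1 / (2 * d) *
        (u x * gam x (k + 2) * (2 * d * gam x k ^ 2 * (b (k + 2) - b k)
            - (b k - b (k + 1)) * (b k - b (k + 2)))
          - p x (k + 1) * (2 * d * gam x (k + 1) * gam x (k + 2) * gam x k ^ 2
            * (b (k + 2) - b k))
          + p x (k + 2) * gam x k ^ 2 * (2 * d * gam x (k + 1) ^ 2 * (b (k + 1) - b k)
            + b k * (b (k + 2) - b (k + 1)))
          + p x k * gam x (k + 2) * gam x k * (2 * d * gam x (k + 1) ^ 2
            * (b (k + 2) - b (k + 1)) + b k * (b (k + 1) - b k))) := by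
  obtain ⟨hu, hp, hu1, hu2, hp1, hp2, hH⟩ := h
  have hq0 := hp 0
  have hq1 := hp 1
  have hq2 := hp 2
  unfold adjBivector
  generalize -1 / (2 * d) = c
  fin_cases k <;>
    (simp (disch := fun_prop) only [schouten, Fintype.sum_sum_type, Fin.sum_univ_three,
      canonicalP, blockBivector, Matrix.fromBlocks_apply₁₁, Matrix.fromBlocks_apply₁₂,
      Matrix.fromBlocks_apply₂₁, Matrix.fromBlocks_apply₂₂, Matrix.neg_apply,
      Matrix.transpose_apply, Matrix.smul_apply, Matrix.zero_apply, Matrix.mul_apply, skew, adjS,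
      Matrix.adjugate_fin_three, symS, Matrix.of_apply, Matrix.cons_val, Matrix.mulVec,
      dotProduct, gam, mom, smul_eq_mul, pd_add, pd_sub, pd_mul, pd_neg, pd_pow, pd_const,
      pd_coord, hu1, hu2, hp1, hp2, Sum.inl.injEq, Sum.inr.injEq, reduceCtorEq, if_true,
      if_false, Fin.isValue, zero_mul, mul_zero, add_zero, zero_add, mul_one, sub_zero, zero_sub,
      neg_zero, Fin.reduceEq, Fin.zero_eta, Fin.mk_one, Fin.reduceFinMk, Fin.reduceAdd,
      Nat.add_one_sub_one, pow_one]
     ring)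

theorem bCoef_ne {I : Fin 3 → ℝ} {d : ℝ} {i j : Fin 3} (h : I i ≠ I j) :
    bCoef I d i - bCoef I d j ≠ 0 := by
  have e : bCoef I d i - bCoef I d j = 2 * (I j - I i) := by
    simp only [bCoef]; ring
  rw [e]
  exact mul_ne_zero two_ne_zero (sub_ne_zero.2 h.symm)

/-- Of three numbers that are not all equal, one differs from the other two. -/
theorem exists_ne_succ {I : Fin 3 → ℝ} (hI : ∃ i j, I i ≠ I j) :
    ∃ k : Fin 3, I k ≠ I (k + 1) ∧ I k ≠ I (k + 2) := by
  by_contra! h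
  have h0 := h 0
  have h1 := h 1
  have h2 := h 2
  simp only [zero_add, Fin.isValue, show (1 : Fin 3) + 1 = 2 from rfl,
    show (1 : Fin 3) + 2 = 0 from rfl, show (2 : Fin 3) + 1 = 0 from rfl,
    show (2 : Fin 3) + 2 = 1 from rfl] at h0 h1 h2
  have h01 : I 0 = I 1 := by
    by_contra hne
    have := h0 hne
    have := h1 (fun e => hne (by rw [this, e]))
    exact hne this.symm
  have h12 : I 1 = I 2 := by
    by_contra hne
    exact hne ((h1 hne).symm ▸ h01 ▸ h2 (fun e => hne (by rw [e, h01])) |>.symm)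
  obtain ⟨i, j, hij⟩ := hI
  refine hij ?_
  fin_cases i <;> fin_cases j <;> simp [h01, h12]

/-- On a nonempty open set some component of `[P, P_b]` is nonzero at some point. -/
theorem exists_schouten_canonicalP_Pb_ne_zero {I : Fin 3 → ℝ} {d : ℝ} (hI : ∀ i, 0 < I i)
    (hd : 0 < d) (hasym : ∃ i j, I i ≠ I j) {W : Set Phase} (hW : IsOpen W) (hne : W.Nonempty)
    (hsub : W ⊆ regularSet I d) :
    ∃ x ∈ W, ∃ k : Fin 3,
      schouten canonicalP (Pb I d) x (.inl (k + 1)) (.inr (k + 1)) (.inr (k + 2)) ≠ 0 := by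
  by_contra! hcon
  obtain ⟨k, hk1, hk2⟩ := exists_ne_succ hasym
  rw [Pb_eq_adjBivector hI hd] at hcon
  -- `F` is the chosen component of `[P, P_b]` times `-2 d g`, a polynomial in `γ`
  let A : Phase → ℝ := fun x => x (.inl (k + 2))
    * (2 * d * x (.inl k) ^ 2 * (bCoef I d (k + 2) - bCoef I d k)
      - (bCoef I d k - bCoef I d (k + 1)) * (bCoef I d k - bCoef I d (k + 2)))
  let B : Phase → ℝ := fun x =>
    -aCoef I d (k + 1) * x (.inl (k + 1)) * (2 * d * x (.inl (k + 1)) * x (.inl (k + 2))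
        * x (.inl k) ^ 2 * (bCoef I d (k + 2) - bCoef I d k))
      + aCoef I d (k + 2) * x (.inl (k + 2)) * x (.inl k) ^ 2 * (2 * d * x (.inl (k + 1)) ^ 2
        * (bCoef I d (k + 1) - bCoef I d k)
        + bCoef I d k * (bCoef I d (k + 2) - bCoef I d (k + 1)))
      + aCoef I d k * x (.inl k) * x (.inl (k + 2)) * x (.inl k)
        * (2 * d * x (.inl (k + 1)) ^ 2 * (bCoef I d (k + 2) - bCoef I d (k + 1))
        + bCoef I d k * (bCoef I d (k + 1) - bCoef I d k))
  let F : Phase → ℝ := fun x => (1 - d * ∑ i, aCoef I d i * x (.inl i) ^ 2) * A x - d * B x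
  have hF : ∀ x ∈ W, F x = 0 := by
    intro x hx
    have hg := (g_pos (hsub hx)).ne'
    have h := hcon x hx k
    rw [schouten_canonicalP_adjBivector _ _ (isGammaPotentialAt_g (hsub hx))] at h
    have h := (mul_eq_zero.1 h).resolve_left (by positivity)
    have hw := g_eq I d (gam x)
    have h' := congrArg (g I d (gam x) * ·) h
    simp only [gradG, mul_zero] at h'
    rw [← h']
    have hw2 : g I d (gam x) * g I d (gam x) = gSq I d (gam x) := by
      nth_rewrite 2 [hw]
      field_simp
    have hw3 : g I d (gam x) * (g I d (gam x))⁻¹ = 1 := mul_inv_cancel₀ hg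
    generalize (g I d (gam x))⁻¹ = gi at *
    simp only [F, A]
    have hw4 : (1 - d * ∑ i, aCoef I d i * x (.inl i) ^ 2) = gSq I d (gam x) := rfl
    rw [hw4, ← hw2]
    simp only [gam] at *
    generalize g I d (fun i => x (Sum.inl i)) = gg at *
    linear_combination d * B x * hw3
  have hFan : AnalyticOnNhd ℝ F Set.univ := by
    rw [← contDiff_omega_iff_analyticOnNhd]
    simp only [F, A, B]
    fun_prop
  obtain ⟨x0, hx0⟩ := hne
  have hF0 : F = fun _ => 0 :=
    hFan.eq_of_eventuallyEq (fun x _ => analyticAt_const) (z₀ := x0)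
      (Filter.eventuallyEq_of_mem (hW.mem_nhds hx0) hF)
  -- at the unit vector of the axis `k + 2` only the term `(bₖ - bᵢ) (bₖ - bⱼ) γⱼ` is left
  have h1 := congrFun hF0 (Pi.single (.inl (k + 2)) 1)
  have e0 : (k + 2 : Fin 3) ≠ k := by fin_cases k <;> decide
  have hsum : ∑ i, aCoef I d i
      * (Pi.single (M := fun _ => ℝ) (Sum.inl (k + 2) : Fin 3 ⊕ Fin 3) 1 (Sum.inl i)) ^ 2
      = aCoef I d (k + 2) := by
    rw [Finset.sum_eq_single (k + 2)]
    · simp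
    · intro j _ hj
      simp [hj]
    · simp
  simp only [F, A, B, hsum] at h1
  have e1 : Pi.single (M := fun _ => ℝ) (Sum.inl (k + 2) : Fin 3 ⊕ Fin 3) 1 (Sum.inl k) = 0 := by
    simp [e0.symm]
  rw [e1] at h1
  have ha : 1 - d * aCoef I d (k + 2) ≠ 0 := by
    have h2 := hI (k + 2)
    have : 1 - d * aCoef I d (k + 2) = I (k + 2) / (I (k + 2) + d) := by
      simp only [aCoef]; field_simp; ring
    rw [this]
    positivity
  have hb1 := bCoef_ne (d := d) hk1
  have hb2 := bCoef_ne (d := d) hk2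
  simp [ha, hb1, hb2] at h1

set_option linter.unusedSimpArgs false in
set_option maxHeartbeats 2000000 in
/-- Coboundaries are cocycles: `[P, L_Y P]` vanishes, by the Jacobi identity and the
symmetry of the second derivatives of `Y`. -/
theorem schouten_canonicalP_lieDeriv {Y : Phase → Phase} {x : Phase} (hY : ContDiffAt ℝ 2 Y x)
    (k : Fin 3) :
    schouten canonicalP (fun y => Matrix.of (lieDerivBivector Y canonicalP y)) x
      (.inl (k + 1)) (.inr (k + 1)) (.inr (k + 2)) = 0 := by
  have hdiff : ∀ i, DifferentiableAt ℝ (fun y => Y y i) x := fun i =>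
    (differentiableAt_pi.1 (hY.differentiableAt (by norm_num))) i
  obtain ⟨D, hD⟩ : ∃ D : Fin 3 ⊕ Fin 3 → Fin 3 ⊕ Fin 3 → Phase → ℝ,
      ∀ i l y, pd (fun z => Y z i) l y = D i l y := ⟨_, fun _ _ _ => rfl⟩
  have hYi : ∀ i, ContDiffAt ℝ 2 (fun y => Y y i) x := fun i => contDiffAt_pi.1 hY i
  have hfd : ∀ i, DifferentiableAt ℝ (fderiv ℝ fun y => Y y i) x := fun i =>
    ((hYi i).fderiv_right (m := 1) (by norm_num)).differentiableAt (by norm_num)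
  have hDe : ∀ i l, D i l = fun y => fderiv ℝ (fun y => Y y i) y (Pi.single l 1) := fun i l => by
    ext y; rw [← hD]; rfl
  have hDd : ∀ i l, DifferentiableAt ℝ (fun y => D i l y) x := fun i l => by
    have := hfd i
    simp only [hDe]
    fun_prop
  have hDD : ∀ i l m, pd (fun y => D i l y) m x = pd (fun y => D i m y) l x := fun i l m => by
    have hs := (hYi i).isSymmSndFDerivAt (by simp)
    have e : ∀ l m, pd (fun y => D i l y) m x
        = fderiv ℝ (fderiv ℝ fun y => Y y i) x (Pi.single m 1) (Pi.single l 1) := by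
      intro l m
      simp only [hDe, pd]
      rw [fderiv_clm_apply (hfd i) (differentiableAt_const _)]
      simp
    rw [e, e, hs]
  fin_cases k <;>
    (simp (disch := fun_prop) only [schouten, lieDerivBivector, Fintype.sum_sum_type,
      Fin.sum_univ_three, canonicalP, blockBivector, Matrix.fromBlocks_apply₁₁,
      Matrix.fromBlocks_apply₁₂, Matrix.fromBlocks_apply₂₁, Matrix.fromBlocks_apply₂₂,
      Matrix.neg_apply, Matrix.transpose_apply, Matrix.zero_apply, skew, Matrix.of_apply,
      Matrix.cons_val, gam, mom, pd_add, pd_sub, pd_mul, pd_neg, pd_const, pd_coord, hD,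
      Sum.inl.injEq, Sum.inr.injEq, reduceCtorEq, if_true, if_false, Fin.isValue, zero_mul,
      mul_zero, add_zero, zero_add, mul_one, sub_zero, zero_sub, neg_zero, Fin.reduceEq,
      Fin.zero_eta, Fin.mk_one, Fin.reduceFinMk, Fin.reduceAdd]
     simp only [hDD]
     ring)

theorem schouten_congr_right {P Q Q' : BivectorField} {x : Phase}
    (h : ∀ i j, (fun y => Q y i j) =ᶠ[nhds x] fun y => Q' y i j) (i j k : Fin 3 ⊕ Fin 3) :
    schouten P Q x i j k = schouten P Q' x i j k := by
  have e1 : ∀ i j, Q x i j = Q' x i j := fun i j => (h i j).eq_of_nhds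
  have e2 : ∀ i j l, pd (fun y => Q y i j) l x = pd (fun y => Q' y i j) l x := fun i j l => by
    simp only [pd, (h i j).fderiv_eq]
  simp only [schouten, e1, e2]

theorem not_compatibleOn_Pb {I : Fin 3 → ℝ} {d : ℝ} (hI : ∀ i, 0 < I i) (hd : 0 < d)
    (hasym : ∃ i j, I i ≠ I j) {W : Set Phase} (hW : IsOpen W) (hne : W.Nonempty)
    (hsub : W ⊆ regularSet I d) : ¬ CompatibleOn canonicalP (Pb I d) W := by
  intro h
  obtain ⟨x, hx, k, hk⟩ := exists_schouten_canonicalP_Pb_ne_zero hI hd hasym hW hne hsub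
  exact hk (h x hx _ _ _)

theorem not_isTrivialDeformationOn_Pb {I : Fin 3 → ℝ} {d : ℝ} (hI : ∀ i, 0 < I i) (hd : 0 < d)
    (hasym : ∃ i j, I i ≠ I j) {W : Set Phase} (hW : IsOpen W) (hne : W.Nonempty)
    (hsub : W ⊆ regularSet I d) : ¬ IsTrivialDeformationOn canonicalP (Pb I d) W := by
  rintro ⟨Y, hY, h⟩
  obtain ⟨x, hx, k, hk⟩ := exists_schouten_canonicalP_Pb_ne_zero hI hd hasym hW hne hsub
  have hnh := hW.mem_nhds hx
  refine hk ?_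
  rw [schouten_congr_right (Q' := fun y => Matrix.of (lieDerivBivector Y canonicalP y))]
  · exact schouten_canonicalP_lieDeriv ((hY.contDiffAt hnh).of_le (by norm_cast)) k
  · intro i j
    filter_upwards [hnh] with y hy
    exact h y hy i j

/-! ### Smooth antiderivatives along the fibres of an open set -/

open MeasureTheory Set in
/-- An integral over `[0, 1]` depends smoothly on parameters if the integrand is smooth. It is a
convolution with the indicator function of `[0, 1]`, after a smooth cutoff in the integration
variable. -/
theorem contDiffAt_integral_param {E : Type*} [NormedAddCommGroup E] [NormedSpace ℝ E]
    {F : E × ℝ → ℝ} {O : Set (E × ℝ)} (hO : IsOpen O) (hF : ContDiffOn ℝ ∞ F O) {p : E}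
    (hp : ∀ t ∈ Icc (0 : ℝ) 1, (p, t) ∈ O) :
    ContDiffAt ℝ ∞ (fun q => ∫ t in (0 : ℝ)..1, F (q, t)) p := by
  obtain ⟨u, v, hu, hv, hpu, hIv, huv⟩ := generalized_tube_lemma (isCompact_singleton (x := p))
    (isCompact_Icc (a := (0 : ℝ)) (b := 1)) hO (by rintro ⟨q, t⟩ ⟨rfl, ht⟩; exact hp t ht)
  obtain ⟨δ, hδ, hδv⟩ := (isCompact_Icc (a := (0 : ℝ)) (b := 1)).exists_cthickening_subset_open
    hv hIv
  -- the cutoff is `1` on `[-1, 0]`; the integral is the value at `0` of the convolution with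
  -- `s ↦ χ s * F (q, -s)`, whence the reflection of the interval
  let χ : ContDiffBump (-(1 / 2) : ℝ) := ⟨1 / 2 + δ / 2, 1 / 2 + δ, by positivity, by linarith⟩
  have hχv : ∀ s, s ∈ Metric.closedBall (-(1 / 2) : ℝ) (1 / 2 + δ) → -s ∈ v := by
    intro s hs
    rw [Real.closedBall_eq_Icc] at hs
    refine hδv (Metric.mem_cthickening_of_dist_le (-s) (max 0 (min 1 (-s))) _ _ ?_ ?_)
    · exact ⟨le_max_left _ _, max_le zero_le_one (min_le_left _ _)⟩
    · rw [Real.dist_eq, abs_le]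
      obtain ⟨h1, h2⟩ := hs
      rcases le_total 1 (-s) with h | h
      · rw [min_eq_left h]
        norm_num
        constructor <;> linarith
      · rw [min_eq_right h]
        rcases le_total 0 (-s) with h' | h'
        · rw [max_eq_right h']; constructor <;> linarith
        · rw [max_eq_left h']; constructor <;> linarith
  have hχ0 : ∀ s, s ∉ Metric.closedBall (-(1 / 2) : ℝ) (1 / 2 + δ) → χ s = 0 := fun s hs =>
    χ.zero_of_le_dist (not_le.1 fun h => hs h).le
  have hsm : ContDiffOn ℝ ∞ (Function.uncurry fun (q : E) (s : ℝ) => χ s * F (q, -s))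
      (u ×ˢ univ) := by
    rintro ⟨q, s⟩ ⟨hq, -⟩
    refine ContDiffAt.contDiffWithinAt ?_
    by_cases hs : s ∈ Metric.closedBall (-(1 / 2) : ℝ) (1 / 2 + δ)
    · have h1 : ContDiffAt ℝ ∞ F (q, -s) := hF.contDiffAt (hO.mem_nhds (huv ⟨hq, hχv s hs⟩))
      have h2 : ContDiffAt ℝ ∞ (fun z : E × ℝ => F (z.1, -z.2)) (q, s) :=
        ContDiffAt.comp (q, s) (f := fun z : E × ℝ => (z.1, -z.2)) h1 (by fun_prop)
      exact (χ.contDiff.contDiffAt.comp (q, s) contDiffAt_snd).mul h2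
    · have h0 : ∀ᶠ z : E × ℝ in nhds (q, s), (Function.uncurry fun (q : E) (s : ℝ) =>
          χ s * F (q, -s)) z = 0 := by
        have : {z : E × ℝ | z.2 ∈ (Metric.closedBall (-(1 / 2) : ℝ) (1 / 2 + δ))ᶜ} ∈ nhds (q, s) :=
          (Metric.isClosed_closedBall.isOpen_compl.preimage continuous_snd).mem_nhds hs
        filter_upwards [this] with z hz
        simp [Function.uncurry, hχ0 z.2 hz]
      exact (contDiffAt_const (c := (0 : ℝ))).congr_of_eventuallyEq h0
  have hconv := contDiffOn_convolution_right_with_param_comp (n := ⊤) (μ := volume)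
    (ContinuousLinearMap.mul ℝ ℝ) (s := u) (v := fun _ => (0 : ℝ)) contDiffOn_const
    (f := (Ioc (0 : ℝ) 1).indicator fun _ => (1 : ℝ))
    (g := fun (q : E) (s : ℝ) => χ s * F (q, -s)) hu
    (isCompact_closedBall (-(1 / 2) : ℝ) (1 / 2 + δ))
    (fun q s _ hs => by simp [hχ0 s hs])
    ((integrable_indicator_iff measurableSet_Ioc).2
      (integrableOn_const (by simp))).locallyIntegrable hsm
  refine (hconv.contDiffAt (hu.mem_nhds (hpu rfl))).congr_of_eventuallyEq
    (Filter.Eventually.of_forall fun q => ?_)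
  beta_reduce
  rw [intervalIntegral.integral_of_le zero_le_one, convolution,
    ← integral_indicator measurableSet_Ioc]
  refine integral_congr_ae (Filter.Eventually.of_forall fun t => ?_)
  by_cases ht : t ∈ Ioc (0 : ℝ) 1
  · have : χ (-t) = 1 := χ.one_of_mem_closedBall (by
      rw [Real.closedBall_eq_Icc]
      show -(1 / 2) - (1 / 2 + δ / 2) ≤ -t ∧ -t ≤ -(1 / 2) + (1 / 2 + δ / 2)
      constructor <;> linarith [ht.1, ht.2])
    simp [ht, this]
  · simp [ht]

open Set Manifold in
/-- An open set with interval fibres over its projection has a smooth section: constant local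
sections are glued by a partition of unity. -/
theorem exists_smooth_section {E : Type*} [NormedAddCommGroup E] [NormedSpace ℝ E]
    [FiniteDimensional ℝ E] {Ω : Set (E × ℝ)} (hΩ : IsOpen Ω)
    (hconv : ∀ u, Convex ℝ {t : ℝ | (u, t) ∈ Ω}) :
    ∃ σ : E → ℝ, ContDiffOn ℝ ∞ σ (Prod.fst '' Ω) ∧ ∀ z ∈ Ω, (z.1, σ z.1) ∈ Ω := by
  classical
  let W : TopologicalSpace.Opens E := ⟨Prod.fst '' Ω, isOpenMap_fst _ hΩ⟩
  have : LocallyCompactSpace W := W.isOpen.locallyCompactSpace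
  have : SecondCountableTopology E := secondCountable_of_proper
  obtain ⟨s, hs⟩ := exists_contMDiffMap_forall_mem_convex_of_local_const (n := ⊤) 𝓘(ℝ, E)
    (M := W) (t := fun w => {t : ℝ | ((w : E), t) ∈ Ω}) (fun w => hconv w) (by
      rintro ⟨w, ⟨w', t⟩, hz, rfl⟩
      refine ⟨t, ?_⟩
      have hc : Continuous fun y : W => ((y : E), t) := by fun_prop
      exact hc.continuousAt.eventually (hΩ.mem_nhds hz))
  let σ : E → ℝ := fun x => if h : x ∈ W then s ⟨x, h⟩ else 0
  have hσ : ∀ w : W, σ w = s w := fun w => by simp [σ]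
  refine ⟨σ, fun x hx => ContDiffAt.contDiffWithinAt ?_, fun z hz => ?_⟩
  · rw [← contMDiffAt_iff_contDiffAt]
    refine (contMDiffAt_subtype_iff (U := W) (x := ⟨x, hx⟩)).1 ?_
    have h := s.contMDiff ⟨x, hx⟩
    exact h.congr_of_eventuallyEq (Filter.Eventually.of_forall fun w => hσ w)
  · have h := hs ⟨z.1, mem_image_of_mem _ hz⟩
    rw [← hσ] at h
    exact h

open Set in
/-- A smooth function on an open set with interval fibres has a smooth antiderivative along the
fibres: integrate from a smooth section. -/
theorem exists_smooth_antideriv {E : Type*} [NormedAddCommGroup E] [NormedSpace ℝ E]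
    [FiniteDimensional ℝ E] {Ω : Set (E × ℝ)} (hΩ : IsOpen Ω)
    (hconv : ∀ u, Convex ℝ {t : ℝ | (u, t) ∈ Ω}) {G : E × ℝ → ℝ} (hG : ContDiffOn ℝ ∞ G Ω) :
    ∃ K : E × ℝ → ℝ, ContDiffOn ℝ ∞ K Ω ∧
      ∀ z ∈ Ω, HasDerivAt (fun t => K (z.1, t)) (G z) z.2 := by
  obtain ⟨σ, hσ, hσΩ⟩ := exists_smooth_section hΩ hconv
  have hW : IsOpen (Prod.fst '' Ω) := isOpenMap_fst _ hΩ
  refine ⟨fun z => ∫ t in σ z.1..z.2, G (z.1, t), ?_, ?_⟩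
  · -- the substitution `t = σ + θ (τ - σ)` makes the limits of integration constant
    have hcov : ∀ z : E × ℝ, ∫ t in σ z.1..z.2, G (z.1, t)
        = (z.2 - σ z.1) * ∫ θ in (0 : ℝ)..1, G (z.1, σ z.1 + θ * (z.2 - σ z.1)) := by
      intro z
      have h := intervalIntegral.smul_integral_comp_add_mul (a := (0 : ℝ)) (b := 1)
        (fun t => G (z.1, t)) (z.2 - σ z.1) (σ z.1)
      simp only [mul_zero, add_zero, mul_one, add_sub_cancel, smul_eq_mul] at h
      rw [← h]
      simp only [mul_comm]
    simp only [hcov]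
    have hσ1 : ContDiffOn ℝ ∞ (fun z : E × ℝ => σ z.1) Ω :=
      hσ.comp contDiffOn_fst fun z hz => mem_image_of_mem _ hz
    refine ContDiffOn.mul (contDiffOn_snd.sub hσ1) fun z hz => ContDiffAt.contDiffWithinAt ?_
    have hm : ContDiffOn ℝ ∞
        (fun y : (E × ℝ) × ℝ => (y.1.1, σ y.1.1 + y.2 * (y.1.2 - σ y.1.1))) (Ω ×ˢ univ) := by
      have h1 : ContDiffOn ℝ ∞ (fun y : (E × ℝ) × ℝ => σ y.1.1) (Ω ×ˢ univ) :=
        hσ1.comp contDiffOn_fst fun y hy => hy.1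
      exact ContDiffOn.prodMk (by fun_prop)
        (h1.add (contDiffOn_snd.mul (ContDiffOn.sub (by fun_prop) h1)))
    have hO := hm.continuousOn.isOpen_inter_preimage (hΩ.prod isOpen_univ) hΩ
    refine contDiffAt_integral_param hO
      (hG.comp (hm.mono inter_subset_left) fun y hy => hy.2) fun θ hθ => ⟨⟨hz, mem_univ _⟩, ?_⟩
    have h := hconv z.1 (x := σ z.1) (hσΩ z hz) (y := z.2) hz (a := 1 - θ) (b := θ)
      (by linarith [hθ.2]) hθ.1 (by ring)
    have e : (1 - θ) • σ z.1 + θ • z.2 = σ z.1 + θ * (z.2 - σ z.1) := by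
      simp only [smul_eq_mul]; ring
    rw [e] at h
    exact h
  · rintro ⟨u, τ⟩ hz
    have hc : Continuous fun t : ℝ => (u, t) := by fun_prop
    have hopen : IsOpen {t : ℝ | (u, t) ∈ Ω} := hΩ.preimage hc
    have hGc : ContinuousOn (fun t => G (u, t)) {t : ℝ | (u, t) ∈ Ω} :=
      hG.continuousOn.comp hc.continuousOn fun t ht => ht
    have hsub : uIcc (σ u) τ ⊆ {t : ℝ | (u, t) ∈ Ω} :=
      (hconv u).ordConnected.uIcc_subset (hσΩ _ hz) hz
    exact intervalIntegral.integral_hasDerivAt_right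
      ((hGc.mono hsub).intervalIntegrable)
      (hGc.stronglyMeasurableAtFilter hopen τ hz)
      (hGc.continuousAt (hopen.mem_nhds hz))

/-! ### Smooth antiderivatives along meridians -/

/-- The point at latitude `arctan t` on the meridian that meets the equatorial plane in `u`, where
`z = (u, t)`. -/
def ofMeridian (z : (ℝ × ℝ) × ℝ) : Fin 3 → ℝ :=
  ![z.1.1 / √(1 + z.2 ^ 2), z.1.2 / √(1 + z.2 ^ 2),
    √(z.1.1 ^ 2 + z.1.2 ^ 2) * z.2 / √(1 + z.2 ^ 2)]

/-- The inverse of `ofMeridian`, away from the third axis. -/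
def toMeridian (γ : Fin 3 → ℝ) : (ℝ × ℝ) × ℝ :=
  ((√(γ 0 ^ 2 + γ 1 ^ 2 + γ 2 ^ 2) * γ 0 / √(γ 0 ^ 2 + γ 1 ^ 2),
    √(γ 0 ^ 2 + γ 1 ^ 2 + γ 2 ^ 2) * γ 1 / √(γ 0 ^ 2 + γ 1 ^ 2)), γ 2 / √(γ 0 ^ 2 + γ 1 ^ 2))

/-- The vector field `(γ₁ γ₃ / ρ, γ₂ γ₃ / ρ, -1)`. It is tangent to the meridians, and it is
normalized so as to be divergence free. -/
def meridianField (γ : Fin 3 → ℝ) : Fin 3 → ℝ :=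
  ![γ 0 * γ 2 / (γ 0 ^ 2 + γ 1 ^ 2), γ 1 * γ 2 / (γ 0 ^ 2 + γ 1 ^ 2), -1]

theorem sqrt_one_add_sq_pos (t : ℝ) : 0 < √(1 + t ^ 2) := Real.sqrt_pos.2 (by positivity)

theorem equator_pos {z : (ℝ × ℝ) × ℝ} (h : ofMeridian z 0 ^ 2 + ofMeridian z 1 ^ 2 ≠ 0) :
    0 < z.1.1 ^ 2 + z.1.2 ^ 2 := by
  refine lt_of_le_of_ne (by positivity) fun h0 => h ?_
  simp only [ofMeridian, Matrix.cons_val, div_pow]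
  rw [← add_div, ← h0, zero_div]

theorem ofMeridian_toMeridian {γ : Fin 3 → ℝ} (h : γ 0 ^ 2 + γ 1 ^ 2 ≠ 0) :
    ofMeridian (toMeridian γ) = γ := by
  have hρ : 0 < γ 0 ^ 2 + γ 1 ^ 2 := lt_of_le_of_ne (by positivity) h.symm
  have hs : 0 < √(γ 0 ^ 2 + γ 1 ^ 2) := Real.sqrt_pos.2 hρ
  have hr : 0 < √(γ 0 ^ 2 + γ 1 ^ 2 + γ 2 ^ 2) := Real.sqrt_pos.2 (by positivity)
  have hs2 := Real.sq_sqrt hρ.le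
  have hr2 := Real.sq_sqrt (show 0 ≤ γ 0 ^ 2 + γ 1 ^ 2 + γ 2 ^ 2 by positivity)
  have h1 : √(1 + (γ 2 / √(γ 0 ^ 2 + γ 1 ^ 2)) ^ 2)
      = √(γ 0 ^ 2 + γ 1 ^ 2 + γ 2 ^ 2) / √(γ 0 ^ 2 + γ 1 ^ 2) := by
    rw [Real.sqrt_eq_iff_eq_sq (by positivity) (by positivity), div_pow, div_pow, hs2, hr2]
    field_simp
  have h2 : √((√(γ 0 ^ 2 + γ 1 ^ 2 + γ 2 ^ 2) * γ 0 / √(γ 0 ^ 2 + γ 1 ^ 2)) ^ 2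
      + (√(γ 0 ^ 2 + γ 1 ^ 2 + γ 2 ^ 2) * γ 1 / √(γ 0 ^ 2 + γ 1 ^ 2)) ^ 2)
      = √(γ 0 ^ 2 + γ 1 ^ 2 + γ 2 ^ 2) := by
    congr 1
    rw [div_pow, div_pow, mul_pow, mul_pow, hs2, hr2]
    field_simp
  ext i
  fin_cases i
  · simp only [ofMeridian, toMeridian, h1, Fin.zero_eta, Matrix.cons_val]
    field_simp
  · simp only [ofMeridian, toMeridian, h1, Fin.mk_one, Matrix.cons_val]
    field_simp
  · simp only [ofMeridian, toMeridian, h1, h2, Fin.reduceFinMk, Matrix.cons_val]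
    field_simp

theorem toMeridian_ofMeridian {z : (ℝ × ℝ) × ℝ} (h : 0 < z.1.1 ^ 2 + z.1.2 ^ 2) :
    toMeridian (ofMeridian z) = z := by
  obtain ⟨⟨u, v⟩, t⟩ := z
  simp only at h
  have hq := sqrt_one_add_sq_pos t
  have hq2 := Real.sq_sqrt (show 0 ≤ 1 + t ^ 2 by positivity)
  have hs : 0 < √(u ^ 2 + v ^ 2) := Real.sqrt_pos.2 h
  have hs2 := Real.sq_sqrt h.le
  have h1 : √((u / √(1 + t ^ 2)) ^ 2 + (v / √(1 + t ^ 2)) ^ 2)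
      = √(u ^ 2 + v ^ 2) / √(1 + t ^ 2) := by
    rw [Real.sqrt_eq_iff_eq_sq (by positivity) (by positivity), div_pow, div_pow, div_pow, hs2]
    ring
  have h2 : √((u / √(1 + t ^ 2)) ^ 2 + (v / √(1 + t ^ 2)) ^ 2
      + (√(u ^ 2 + v ^ 2) * t / √(1 + t ^ 2)) ^ 2) = √(u ^ 2 + v ^ 2) := by
    rw [Real.sqrt_eq_iff_eq_sq (by positivity) (by positivity), div_pow, div_pow, div_pow, mul_pow,
      hs2, hq2]
    field_simp
  simp only [toMeridian, ofMeridian, Matrix.cons_val, h1, h2]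
  ext <;> simp only <;> field_simp

theorem contDiffAt_toMeridian {γ : Fin 3 → ℝ} (h : γ 0 ^ 2 + γ 1 ^ 2 ≠ 0) :
    ContDiffAt ℝ ∞ toMeridian γ := by
  have hρ : 0 < γ 0 ^ 2 + γ 1 ^ 2 := lt_of_le_of_ne (by positivity) h.symm
  have hs : √(γ 0 ^ 2 + γ 1 ^ 2) ≠ 0 := (Real.sqrt_pos.2 hρ).ne'
  have h1 : ContDiffAt ℝ ∞ (fun γ : Fin 3 → ℝ => √(γ 0 ^ 2 + γ 1 ^ 2)) γ :=
    ContDiffAt.sqrt (by fun_prop) h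
  have h2 : ContDiffAt ℝ ∞ (fun γ : Fin 3 → ℝ => √(γ 0 ^ 2 + γ 1 ^ 2 + γ 2 ^ 2)) γ :=
    ContDiffAt.sqrt (by fun_prop) (by positivity)
  exact (((h2.mul (by fun_prop)).div h1 hs).prodMk ((h2.mul (by fun_prop)).div h1 hs)).prodMk
    (ContDiffAt.div (by fun_prop) h1 hs)

theorem contDiffAt_ofMeridian {z : (ℝ × ℝ) × ℝ} (h : 0 < z.1.1 ^ 2 + z.1.2 ^ 2) :
    ContDiffAt ℝ ∞ ofMeridian z := by
  have hq : ContDiffAt ℝ ∞ (fun z : (ℝ × ℝ) × ℝ => √(1 + z.2 ^ 2)) z :=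
    ContDiffAt.sqrt (by fun_prop) (by positivity)
  have hq0 : √(1 + z.2 ^ 2) ≠ 0 := (sqrt_one_add_sq_pos _).ne'
  have h1 : ContDiffAt ℝ ∞ (fun z : (ℝ × ℝ) × ℝ => √(z.1.1 ^ 2 + z.1.2 ^ 2)) z :=
    ContDiffAt.sqrt (by fun_prop) h.ne'
  rw [contDiffAt_pi]
  intro i
  fin_cases i
  · exact ContDiffAt.div (by fun_prop) hq hq0
  · exact ContDiffAt.div (by fun_prop) hq hq0
  · exact (h1.mul (by fun_prop)).div hq hq0

theorem continuous_ofMeridian : Continuous ofMeridian := by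
  have hq0 : ∀ z : (ℝ × ℝ) × ℝ, √(1 + z.2 ^ 2) ≠ 0 := fun z => (sqrt_one_add_sq_pos _).ne'
  refine continuous_pi fun i => ?_
  fin_cases i
  · exact Continuous.div (by fun_prop) (by fun_prop) hq0
  · exact Continuous.div (by fun_prop) (by fun_prop) hq0
  · exact Continuous.div (by fun_prop) (by fun_prop) hq0

theorem hasDerivAt_ofMeridian (u : ℝ × ℝ) (t : ℝ) :
    HasDerivAt (fun t => ofMeridian (u, t)) ![-u.1 * t / √(1 + t ^ 2) ^ 3,
      -u.2 * t / √(1 + t ^ 2) ^ 3, √(u.1 ^ 2 + u.2 ^ 2) / √(1 + t ^ 2) ^ 3] t := by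
  have hq0 : √(1 + t ^ 2) ≠ 0 := (sqrt_one_add_sq_pos _).ne'
  have hq2 := Real.sq_sqrt (show 0 ≤ 1 + t ^ 2 by positivity)
  have hq : HasDerivAt (fun t : ℝ => √(1 + t ^ 2)) (t / √(1 + t ^ 2)) t := by
    have h := ((hasDerivAt_pow 2 t).const_add 1).sqrt (by positivity)
    convert h using 1
    field_simp
    norm_num
    ring
  have h0 : ∀ c : ℝ, HasDerivAt (fun t : ℝ => c / √(1 + t ^ 2)) (-c * t / √(1 + t ^ 2) ^ 3) t := by
    intro c
    refine ((hasDerivAt_const t c).div hq hq0).congr_deriv ?_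
    field_simp
    ring
  have h2 : ∀ c : ℝ, HasDerivAt (fun t : ℝ => c * t / √(1 + t ^ 2)) (c / √(1 + t ^ 2) ^ 3) t := by
    intro c
    refine (((hasDerivAt_id t).const_mul c).div hq hq0).congr_deriv ?_
    simp only [id]
    field_simp
    rw [hq2]
    ring
  rw [hasDerivAt_pi]
  intro i
  fin_cases i
  · exact h0 u.1
  · exact h0 u.2
  · exact h2 (√(u.1 ^ 2 + u.2 ^ 2))

theorem equator_eq_of_mem_meridian {γ δ : Fin 3 → ℝ} (hγ : γ 0 ^ 2 + γ 1 ^ 2 ≠ 0)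
    (hδ : δ ∈ meridian γ) : (toMeridian δ).1 = (toMeridian γ).1 := by
  obtain ⟨h1, h2, h3⟩ := hδ
  have hγ' : 0 < γ 0 ^ 2 + γ 1 ^ 2 := lt_of_le_of_ne (by positivity) hγ.symm
  have hr : δ 0 ^ 2 + δ 1 ^ 2 + δ 2 ^ 2 = γ 0 ^ 2 + γ 1 ^ 2 + γ 2 ^ 2 := by
    simp only [dotProduct, Fin.sum_univ_three] at h1
    linarith
  have hδ' : 0 < δ 0 ^ 2 + δ 1 ^ 2 := by
    refine lt_of_le_of_ne (by positivity) fun h0 => ?_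
    have e0 : δ 0 = 0 := by nlinarith [sq_nonneg (δ 0), sq_nonneg (δ 1)]
    have e1 : δ 1 = 0 := by nlinarith [sq_nonneg (δ 0), sq_nonneg (δ 1)]
    simp [e0, e1] at h3
  have hs : 0 < √(γ 0 ^ 2 + γ 1 ^ 2) := Real.sqrt_pos.2 hγ'
  have hs2 := Real.sq_sqrt hγ'.le
  have ht : 0 < √(δ 0 ^ 2 + δ 1 ^ 2) := Real.sqrt_pos.2 hδ'
  have hD : δ 0 * γ 0 + δ 1 * γ 1 = √(δ 0 ^ 2 + δ 1 ^ 2) * √(γ 0 ^ 2 + γ 1 ^ 2) := by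
    rw [← Real.sqrt_mul hδ'.le, eq_comm, Real.sqrt_eq_iff_eq_sq (by positivity) h3.le]
    linear_combination (δ 0 * γ 1 - δ 1 * γ 0) * h2
  have e0 : δ 0 * √(γ 0 ^ 2 + γ 1 ^ 2) = γ 0 * √(δ 0 ^ 2 + δ 1 ^ 2) := by
    refine mul_right_cancel₀ hs.ne' ?_
    linear_combination δ 0 * hs2 + γ 1 * h2 + γ 0 * hD
  have e1 : δ 1 * √(γ 0 ^ 2 + γ 1 ^ 2) = γ 1 * √(δ 0 ^ 2 + δ 1 ^ 2) := by
    refine mul_right_cancel₀ hs.ne' ?_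
    linear_combination δ 1 * hs2 - γ 0 * h2 + γ 1 * hD
  simp only [toMeridian, hr]
  ext
  · simp only
    rw [div_eq_div_iff ht.ne' hs.ne']
    linear_combination √(γ 0 ^ 2 + γ 1 ^ 2 + γ 2 ^ 2) * e0
  · simp only
    rw [div_eq_div_iff ht.ne' hs.ne']
    linear_combination √(γ 0 ^ 2 + γ 1 ^ 2 + γ 2 ^ 2) * e1

theorem ofMeridian_mem_meridian {u : ℝ × ℝ} (hu : 0 < u.1 ^ 2 + u.2 ^ 2) (s t : ℝ) :
    ofMeridian (u, s) ∈ meridian (ofMeridian (u, t)) := by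
  have hs := sqrt_one_add_sq_pos s
  have ht := sqrt_one_add_sq_pos t
  have key : ∀ t, ofMeridian (u, t) ⬝ᵥ ofMeridian (u, t) = u.1 ^ 2 + u.2 ^ 2 := by
    intro t
    have hq := sqrt_one_add_sq_pos t
    have hq2 := Real.sq_sqrt (show 0 ≤ 1 + t ^ 2 by positivity)
    have hr2 := Real.sq_sqrt hu.le
    simp only [ofMeridian, dotProduct, Fin.sum_univ_three, Matrix.cons_val]
    field_simp
    rw [hq2, hr2]
    ring
  refine ⟨by rw [key, key], ?_, ?_⟩
  · simp only [ofMeridian, Matrix.cons_val]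
    ring
  · simp only [ofMeridian, Matrix.cons_val]
    have : u.1 / √(1 + s ^ 2) * (u.1 / √(1 + t ^ 2)) + u.2 / √(1 + s ^ 2) * (u.2 / √(1 + t ^ 2))
        = (u.1 ^ 2 + u.2 ^ 2) / (√(1 + s ^ 2) * √(1 + t ^ 2)) := by
      field_simp
    rw [this]
    positivity

/-- In the coordinates of `ofMeridian`, a set that meets meridians in connected sets has intervals
as fibres. -/
theorem convex_latitudes {V : Set (Fin 3 → ℝ)} (hρ : ∀ γ ∈ V, γ 0 ^ 2 + γ 1 ^ 2 ≠ 0)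
    (hconn : ∀ γ ∈ V, IsPreconnected (V ∩ meridian γ)) (u : ℝ × ℝ) :
    Convex ℝ {t : ℝ | ofMeridian (u, t) ∈ V} := by
  rcases Set.eq_empty_or_nonempty {t : ℝ | ofMeridian (u, t) ∈ V} with h | ⟨t, ht⟩
  · rw [h]; exact convex_empty
  · have hu := equator_pos (hρ _ ht)
    have himg : {t : ℝ | ofMeridian (u, t) ∈ V}
        = (fun γ => (toMeridian γ).2) '' (V ∩ meridian (ofMeridian (u, t))) := by
      ext s
      constructor
      · intro hs
        exact ⟨_, ⟨hs, ofMeridian_mem_meridian hu s t⟩, by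
          simp only [toMeridian_ofMeridian (z := (u, s)) hu]⟩
      · rintro ⟨δ, ⟨hδV, hδ⟩, rfl⟩
        have h1 := equator_eq_of_mem_meridian (hρ _ ht) hδ
        rw [toMeridian_ofMeridian (z := (u, t)) hu] at h1
        have h2 : (u, (toMeridian δ).2) = toMeridian δ := Prod.ext h1.symm rfl
        show ofMeridian (u, (toMeridian δ).2) ∈ V
        rw [h2, ofMeridian_toMeridian (hρ δ hδV)]
        exact hδV
    rw [himg]
    refine ((hconn _ ht).image _ fun γ hγ => ?_).ordConnected.convex
    exact (contDiffAt_toMeridian (hρ γ hγ.1)).continuousAt.snd.continuousWithinAt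

/-- If an open set meets every meridian in a connected set, every smooth function on it has a
smooth antiderivative along the meridians. -/
theorem exists_meridian_antideriv {V : Set (Fin 3 → ℝ)} (hV : IsOpen V)
    (hρ : ∀ γ ∈ V, γ 0 ^ 2 + γ 1 ^ 2 ≠ 0) (hconn : ∀ γ ∈ V, IsPreconnected (V ∩ meridian γ))
    {G : (Fin 3 → ℝ) → ℝ} (hG : ContDiffOn ℝ ∞ G V) :
    ∃ K : (Fin 3 → ℝ) → ℝ, ContDiffOn ℝ ∞ K V ∧
      ∀ γ ∈ V, fderiv ℝ K γ (meridianField γ) = G γ := by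
  have hΩ : IsOpen (ofMeridian ⁻¹' V) := hV.preimage continuous_ofMeridian
  have hΦ : ContDiffOn ℝ ∞ ofMeridian (ofMeridian ⁻¹' V) := fun z hz =>
    (contDiffAt_ofMeridian (equator_pos (hρ _ hz))).contDiffWithinAt
  have hfac : ContDiffOn ℝ ∞ (fun z : (ℝ × ℝ) × ℝ =>
      -(√(z.1.1 ^ 2 + z.1.2 ^ 2) / √(1 + z.2 ^ 2) ^ 3)) (ofMeridian ⁻¹' V) := by
    intro z hz
    have h1 : ContDiffAt ℝ ∞ (fun z : (ℝ × ℝ) × ℝ => √(z.1.1 ^ 2 + z.1.2 ^ 2)) z :=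
      ContDiffAt.sqrt (by fun_prop) (equator_pos (hρ _ hz)).ne'
    have h2 : ContDiffAt ℝ ∞ (fun z : (ℝ × ℝ) × ℝ => √(1 + z.2 ^ 2)) z :=
      ContDiffAt.sqrt (by fun_prop) (by positivity)
    exact (h1.div (h2.pow 3) (pow_ne_zero _ (sqrt_one_add_sq_pos _).ne')).neg.contDiffWithinAt
  obtain ⟨K, hK, hKd⟩ := exists_smooth_antideriv hΩ (convex_latitudes hρ hconn)
    (hfac.mul (hG.comp hΦ fun z hz => hz))
  have hmaps : ∀ γ ∈ V, toMeridian γ ∈ ofMeridian ⁻¹' V := fun γ hγ => by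
    simpa only [Set.mem_preimage, ofMeridian_toMeridian (hρ γ hγ)] using hγ
  have hKs : ContDiffOn ℝ ∞ (fun γ => K (toMeridian γ)) V :=
    hK.comp (fun γ hγ => (contDiffAt_toMeridian (hρ γ hγ)).contDiffWithinAt) hmaps
  refine ⟨fun γ => K (toMeridian γ), hKs, fun γ hγ => ?_⟩
  obtain ⟨⟨u, t⟩, hz⟩ : ∃ z, z = toMeridian γ := ⟨_, rfl⟩
  have hγz : ofMeridian (u, t) = γ := by rw [hz, ofMeridian_toMeridian (hρ γ hγ)]
  have hmem : ofMeridian (u, t) ∈ V := hγz ▸ hγ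
  have hu : 0 < u.1 ^ 2 + u.2 ^ 2 := equator_pos (hρ _ hmem)
  have hd : DifferentiableAt ℝ (fun γ => K (toMeridian γ)) (ofMeridian (u, t)) :=
    (hKs.contDiffAt (hV.mem_nhds hmem)).differentiableAt (by simp)
  have h1 := hd.hasFDerivAt.comp_hasDerivAt t (hasDerivAt_ofMeridian u t)
  have h2 : HasDerivAt (fun s => K (u, s)) _ t := hKd (u, t) hmem
  have h3 : (fun s => K (u, s))
      = (fun γ => K (toMeridian γ)) ∘ fun s => ofMeridian (u, s) := by
    funext s
    simp only [Function.comp, toMeridian_ofMeridian (z := (u, s)) hu]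
  rw [h3] at h2
  have h4 := h1.unique h2
  have hq := sqrt_one_add_sq_pos t
  have hq2 := Real.sq_sqrt (show 0 ≤ 1 + t ^ 2 by positivity)
  have hs : 0 < √(u.1 ^ 2 + u.2 ^ 2) := Real.sqrt_pos.2 hu
  have hs2 := Real.sq_sqrt hu.le
  -- the velocity of the meridian `t ↦ ofMeridian (u, t)` is a multiple of `meridianField`
  have hvel : ![-u.1 * t / √(1 + t ^ 2) ^ 3, -u.2 * t / √(1 + t ^ 2) ^ 3,
      √(u.1 ^ 2 + u.2 ^ 2) / √(1 + t ^ 2) ^ 3]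
      = (-(√(u.1 ^ 2 + u.2 ^ 2) / √(1 + t ^ 2) ^ 3)) • meridianField (ofMeridian (u, t)) := by
    have hρ2 : (u.1 / √(1 + t ^ 2)) ^ 2 + (u.2 / √(1 + t ^ 2)) ^ 2
        = √(u.1 ^ 2 + u.2 ^ 2) ^ 2 / √(1 + t ^ 2) ^ 2 := by
      rw [hs2]; ring
    ext i
    fin_cases i <;>
      simp only [meridianField, ofMeridian, Pi.smul_apply, Matrix.cons_val, smul_eq_mul,
        Fin.zero_eta, Fin.mk_one, Fin.reduceFinMk, hρ2] <;>
      field_simp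
  rw [hvel, map_smul, smul_eq_mul] at h4
  have hne : -(√(u.1 ^ 2 + u.2 ^ 2) / √(1 + t ^ 2) ^ 3) ≠ 0 := by
    rw [neg_ne_zero]; positivity
  have h5 := mul_left_cancel₀ hne h4
  rw [← hγz]
  exact h5

/-! ### Brackets of functions for `P_b` -/

section Bracket

variable {P : BivectorField} {f g h : Phase → ℝ} {x : Phase}

theorem bracket_swap (hP : ∀ i j, P x j i = -P x i j) : bracket P g f x = -bracket P f g x := by
  unfold bracket
  rw [Finset.sum_comm, ← Finset.sum_neg_distrib]
  refine Finset.sum_congr rfl fun i _ => ?_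
  rw [← Finset.sum_neg_distrib]
  refine Finset.sum_congr rfl fun j _ => ?_
  rw [hP i j]
  ring

theorem bracket_add_left (hf : DifferentiableAt ℝ f x) (hg : DifferentiableAt ℝ g x) :
    bracket P (fun y => f y + g y) h x = bracket P f h x + bracket P g h x := by
  unfold bracket
  rw [← Finset.sum_add_distrib]
  refine Finset.sum_congr rfl fun i _ => ?_
  rw [← Finset.sum_add_distrib]
  refine Finset.sum_congr rfl fun j _ => ?_
  rw [pd_add i hf hg]
  ring

theorem bracket_mul_left (hf : DifferentiableAt ℝ f x) (hg : DifferentiableAt ℝ g x) :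
    bracket P (fun y => f y * g y) h x = f x * bracket P g h x + g x * bracket P f h x := by
  unfold bracket
  simp only [Finset.mul_sum]
  rw [← Finset.sum_add_distrib]
  refine Finset.sum_congr rfl fun i _ => ?_
  rw [← Finset.sum_add_distrib]
  refine Finset.sum_congr rfl fun j _ => ?_
  rw [pd_mul i hf hg]
  ring

theorem bracket_congr {f' g' : Phase → ℝ} (hf : f =ᶠ[nhds x] f') (hg : g =ᶠ[nhds x] g') :
    bracket P f g x = bracket P f' g' x := by
  simp only [bracket, pd, hf.fderiv_eq, hg.fderiv_eq]

theorem bracket_eq_zero_of_casimir (hf : ∀ j, ∑ i, P x i j * pd f i x = 0) :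
    bracket P f h x = 0 := by
  unfold bracket
  rw [Finset.sum_comm]
  refine Finset.sum_eq_zero fun j _ => ?_
  rw [← Finset.sum_mul, hf j, zero_mul]

end Bracket

/-- The partial derivatives of a function of `γ`. -/
def pdGam (F : (Fin 3 → ℝ) → ℝ) (l : Fin 3) (γ : Fin 3 → ℝ) : ℝ := fderiv ℝ F γ (Pi.single l 1)

theorem pd_comp_gam_inl {F : (Fin 3 → ℝ) → ℝ} {x : Phase} (hF : DifferentiableAt ℝ F (gam x))
    (l : Fin 3) : pd (fun y => F (gam y)) (.inl l) x = pdGam F l (gam x) := by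
  have hg : HasFDerivAt gam (ContinuousLinearMap.pi fun i : Fin 3 =>
      ContinuousLinearMap.proj (R := ℝ) (φ := fun _ : Fin 3 ⊕ Fin 3 => ℝ) (Sum.inl i)) x :=
    (ContinuousLinearMap.pi fun i : Fin 3 =>
      ContinuousLinearMap.proj (R := ℝ) (φ := fun _ : Fin 3 ⊕ Fin 3 => ℝ) (Sum.inl i)).hasFDerivAt
  have h := hF.hasFDerivAt.comp x hg
  have h' : HasFDerivAt (fun y => F (gam y)) _ x := h
  rw [pd, h'.fderiv, pdGam, ContinuousLinearMap.comp_apply]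
  congr 1
  ext i
  simp [Pi.single_apply]

/-- The vector `𝐒 M`. -/
def symSMom (b : Fin 3 → ℝ) (d : ℝ) (x : Phase) (i : Fin 3) : ℝ := (symS b d (gam x) *ᵥ mom x) i

theorem differentiable_symSMom (b : Fin 3 → ℝ) (d : ℝ) (i : Fin 3) :
    Differentiable ℝ fun x => symSMom b d x i := by
  fin_cases i <;>
    (simp only [symSMom, Matrix.mulVec, dotProduct, symS, gam, mom, Fin.sum_univ_three,
      Matrix.of_apply, Matrix.cons_val, Fin.zero_eta, Fin.mk_one, Fin.reduceFinMk]
     fun_prop)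

theorem pd_symSMom_inr (b : Fin 3 → ℝ) (d : ℝ) (i m : Fin 3) (x : Phase) :
    pd (fun y => symSMom b d y i) (.inr m) x = symS b d (gam x) i m := by
  fin_cases i <;> fin_cases m <;>
    (simp (disch := fun_prop) only [symSMom, Matrix.mulVec, dotProduct, symS, gam, mom,
      Fin.sum_univ_three, Matrix.of_apply, Matrix.cons_val, Fin.zero_eta, Fin.mk_one,
      Fin.reduceFinMk, pd_add, pd_sub, pd_mul, pd_pow, pd_const, pd_coord, Fin.isValue]
     simp)

section AdjBivector

variable (b : Fin 3 → ℝ) (d : ℝ) (u : Phase → ℝ) (p : Phase → Fin 3 → ℝ) (x : Phase)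

theorem bracket_gam_left (F : (Fin 3 → ℝ) → ℝ) (hF : DifferentiableAt ℝ F (gam x))
    (h : Phase → ℝ) :
    bracket (adjBivector b d u p) (fun y => F (gam y)) h x
      = ∑ l, ∑ m, -1 / (2 * d) * u x * (skew (gam x) * adjS b d (gam x)) l m
        * pdGam F l (gam x) * pd h (.inr m) x := by
  simp only [bracket, Fintype.sum_sum_type, pd_comp_gam_inr, pd_comp_gam_inl hF]
  simp [adjBivector, blockBivector]

theorem bracket_gam_gam (F F' : (Fin 3 → ℝ) → ℝ) (hF : DifferentiableAt ℝ F (gam x)) :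
    bracket (adjBivector b d u p) (fun y => F (gam y)) (fun y => F' (gam y)) x = 0 := by
  rw [bracket_gam_left _ _ _ _ _ _ hF]
  simp [pd_comp_gam_inr]

/-- Up to a factor depending on `γ`, the functions `(𝐒 M)ⱼ` act on the functions of `γ` as
infinitesimal rotations. -/
theorem bracket_gam_symSMom (F : (Fin 3 → ℝ) → ℝ) (hF : DifferentiableAt ℝ F (gam x))
    (j : Fin 3) :
    bracket (adjBivector b d u p) (fun y => F (gam y)) (fun y => symSMom b d y j) x
      = -1 / (2 * d) * u x * (symS b d (gam x)).det
        * ∑ l, pdGam F l (gam x) * skew (gam x) l j := by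
  rw [bracket_gam_left _ _ _ _ _ _ hF]
  have hS : ∀ m, symS b d (gam x) j m = symS b d (gam x) m j := fun m => by
    fin_cases j <;> fin_cases m <;> rfl
  have h : ∀ l, ∑ m, (skew (gam x) * adjS b d (gam x)) l m * symS b d (gam x) m j
      = (symS b d (gam x)).det * skew (gam x) l j := by
    intro l
    rw [← Matrix.mul_apply, Matrix.mul_assoc, adjS, Matrix.adjugate_mul]
    simp
  simp only [pd_symSMom_inr, hS]
  rw [Finset.mul_sum]
  refine Finset.sum_congr rfl fun l _ => ?_
  have h' := h l
  rw [mul_left_comm, mul_assoc, ← h', Finset.mul_sum, Finset.mul_sum]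
  exact Finset.sum_congr rfl fun m _ => by ring

set_option linter.unusedSimpArgs false in
set_option maxHeartbeats 2000000 in
/-- The functions `(𝐒 M)ᵢ` span `so(3)` up to factors and up to a multiple of `γ`. -/
theorem bracket_symSMom_symSMom (k : Fin 3) :
    bracket (adjBivector b d u p) (fun y => symSMom b d y (k + 1))
      (fun y => symSMom b d y (k + 2)) x
      = -1 / (2 * d) * (symS b d (gam x)).det * (u x * symSMom b d x k
        + (4 * d * u x * (gam x ⬝ᵥ mom x) + symSMom b d x ⬝ᵥ p x) * gam x k) := by
  generalize hc : -1 / (2 * d) = c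
  fin_cases k <;>
    (simp (disch := fun_prop) only [hc, bracket, Fintype.sum_sum_type, Fin.sum_univ_three,
      adjBivector, blockBivector, Matrix.fromBlocks_apply₁₁, Matrix.fromBlocks_apply₁₂,
      Matrix.fromBlocks_apply₂₁, Matrix.fromBlocks_apply₂₂, Matrix.neg_apply,
      Matrix.transpose_apply, Matrix.smul_apply, Matrix.zero_apply, Matrix.mul_apply, skew, adjS,
      Matrix.adjugate_fin_three, symS, symSMom, Matrix.det_fin_three, Matrix.of_apply,
      Matrix.cons_val, Matrix.mulVec, dotProduct, gam, mom, smul_eq_mul, pd_add, pd_sub, pd_mul,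
      pd_neg, pd_pow, pd_const, pd_coord, Sum.inl.injEq, Sum.inr.injEq, reduceCtorEq, if_true,
      if_false, Fin.isValue, zero_mul, mul_zero, add_zero, zero_add, mul_one, sub_zero, zero_sub,
      neg_zero, Fin.reduceEq, Fin.zero_eta, Fin.mk_one, Fin.reduceFinMk, Fin.reduceAdd,
      Nat.add_one_sub_one, pow_one]
     ring)

set_option linter.unusedSimpArgs false in
set_option maxHeartbeats 2000000 in
/-- `(γ, 𝐁 M)` is a Casimir function. -/
theorem casimir_gamBMom (j : Fin 3 ⊕ Fin 3) :
    ∑ i, adjBivector b d u p x i j * pd (fun y => ∑ i, gam y i * (b i * mom y i)) i x = 0 := by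
  unfold adjBivector
  generalize -1 / (2 * d) = c
  rcases j with j | j <;> fin_cases j <;>
    (simp (disch := fun_prop) only [Fintype.sum_sum_type, Fin.sum_univ_three,
      blockBivector, Matrix.fromBlocks_apply₁₁, Matrix.fromBlocks_apply₁₂,
      Matrix.fromBlocks_apply₂₁, Matrix.fromBlocks_apply₂₂, Matrix.neg_apply,
      Matrix.transpose_apply, Matrix.smul_apply, Matrix.zero_apply, Matrix.mul_apply, skew, adjS,
      Matrix.adjugate_fin_three, symS, Matrix.of_apply,
      Matrix.cons_val, Matrix.mulVec, dotProduct, gam, mom, smul_eq_mul, pd_add, pd_sub, pd_mul,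
      pd_neg, pd_pow, pd_const, pd_coord, Sum.inl.injEq, Sum.inr.injEq, reduceCtorEq, if_true,
      if_false, Fin.isValue, zero_mul, mul_zero, add_zero, zero_add, mul_one, sub_zero, zero_sub,
      neg_zero, Fin.reduceEq, Fin.zero_eta, Fin.mk_one, Fin.reduceFinMk, Fin.reduceAdd]
     ring)

set_option linter.unusedSimpArgs false in
/-- `(γ, γ)` is a Casimir function. -/
theorem casimir_gamSq (j : Fin 3 ⊕ Fin 3) :
    ∑ i, adjBivector b d u p x i j * pd (fun y => gam y ⬝ᵥ gam y) i x = 0 := by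
  unfold adjBivector
  generalize -1 / (2 * d) = c
  rcases j with j | j
  · fin_cases j <;>
      simp (disch := fun_prop) only [Fintype.sum_sum_type, Fin.sum_univ_three,
      blockBivector, Matrix.fromBlocks_apply₁₁, Matrix.fromBlocks_apply₁₂,
      Matrix.fromBlocks_apply₂₁, Matrix.fromBlocks_apply₂₂, Matrix.neg_apply,
      Matrix.transpose_apply, Matrix.smul_apply, Matrix.zero_apply, Matrix.mul_apply, skew, adjS,
      Matrix.adjugate_fin_three, symS, Matrix.of_apply,
      Matrix.cons_val, Matrix.mulVec, dotProduct, gam, mom, smul_eq_mul, pd_add, pd_sub, pd_mul,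
      pd_neg, pd_pow, pd_const, pd_coord, Sum.inl.injEq, Sum.inr.injEq, reduceCtorEq, if_true,
      if_false, Fin.isValue, zero_mul, mul_zero, add_zero, zero_add, mul_one, sub_zero, zero_sub,
      neg_zero, Fin.reduceEq, Fin.zero_eta, Fin.mk_one, Fin.reduceFinMk, Fin.reduceAdd]
  · fin_cases j <;>
      (simp (disch := fun_prop) only [Fintype.sum_sum_type, Fin.sum_univ_three,
      blockBivector, Matrix.fromBlocks_apply₁₁, Matrix.fromBlocks_apply₁₂,
      Matrix.fromBlocks_apply₂₁, Matrix.fromBlocks_apply₂₂, Matrix.neg_apply,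
      Matrix.transpose_apply, Matrix.smul_apply, Matrix.zero_apply, Matrix.mul_apply, skew, adjS,
      Matrix.adjugate_fin_three, symS, Matrix.of_apply,
      Matrix.cons_val, Matrix.mulVec, dotProduct, gam, mom, smul_eq_mul, pd_add, pd_sub, pd_mul,
      pd_neg, pd_pow, pd_const, pd_coord, Sum.inl.injEq, Sum.inr.injEq, reduceCtorEq, if_true,
      if_false, Fin.isValue, zero_mul, mul_zero, add_zero, zero_add, mul_one, sub_zero, zero_sub,
      neg_zero, Fin.reduceEq, Fin.zero_eta, Fin.mk_one, Fin.reduceFinMk, Fin.reduceAdd]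
       ring)

/-- A smooth function of two Casimir functions is a Casimir function. -/
theorem casimir_comp {P : BivectorField} {x : Phase} {φ : ℝ × ℝ → ℝ} {f h : Phase → ℝ}
    (hφ : DifferentiableAt ℝ φ (f x, h x)) (hf : DifferentiableAt ℝ f x)
    (hh : DifferentiableAt ℝ h x) (hfc : ∀ j, ∑ i, P x i j * pd f i x = 0)
    (hhc : ∀ j, ∑ i, P x i j * pd h i x = 0) (j : Fin 3 ⊕ Fin 3) :
    ∑ i, P x i j * pd (fun y => φ (f y, h y)) i x = 0 := by
  have h1 : HasFDerivAt (fun y => φ (f y, h y)) _ x :=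
    hφ.hasFDerivAt.comp x (hf.hasFDerivAt.prodMk hh.hasFDerivAt)
  have h2 : ∀ i, pd (fun y => φ (f y, h y)) i x
      = fderiv ℝ φ (f x, h x) (1, 0) * pd f i x + fderiv ℝ φ (f x, h x) (0, 1) * pd h i x := by
    intro i
    simp only [pd, h1.fderiv, ContinuousLinearMap.comp_apply, ContinuousLinearMap.prod_apply]
    have : ∀ s t : ℝ, ((s, t) : ℝ × ℝ) = s • (1, 0) + t • (0, 1) := by intro s t; simp
    rw [this (fderiv ℝ f x (Pi.single i 1)), map_add, map_smul, map_smul, smul_eq_mul, smul_eq_mul]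
    ring
  simp only [h2, mul_add, Finset.sum_add_distrib]
  have e1 : ∀ (c : ℝ) (k : Phase → ℝ), ∑ i, P x i j * (c * pd k i x)
      = c * ∑ i, P x i j * pd k i x := fun c k => by
    rw [Finset.mul_sum]; exact Finset.sum_congr rfl fun i _ => by ring
  rw [e1, e1, hfc, hhc]
  ring

end AdjBivector

/-! ### Momenta in which `P_b` becomes the canonical bivector -/

section Bracket

variable {P : BivectorField} {f g h : Phase → ℝ} {x : Phase}

theorem bracket_add_right (hf : DifferentiableAt ℝ f x) (hg : DifferentiableAt ℝ g x) :
    bracket P h (fun y => f y + g y) x = bracket P h f x + bracket P h g x := by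
  unfold bracket
  rw [← Finset.sum_add_distrib]
  refine Finset.sum_congr rfl fun i _ => ?_
  rw [← Finset.sum_add_distrib]
  refine Finset.sum_congr rfl fun j _ => ?_
  rw [pd_add j hf hg]
  ring

theorem bracket_mul_right (hf : DifferentiableAt ℝ f x) (hg : DifferentiableAt ℝ g x) :
    bracket P h (fun y => f y * g y) x = f x * bracket P h g x + g x * bracket P h f x := by
  unfold bracket
  simp only [Finset.mul_sum]
  rw [← Finset.sum_add_distrib]
  refine Finset.sum_congr rfl fun i _ => ?_
  rw [← Finset.sum_add_distrib]
  refine Finset.sum_congr rfl fun j _ => ?_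
  rw [pd_mul j hf hg]
  ring

end Bracket

/-- The derivative of a function of `γ` along the infinitesimal rotation about axis `i`. -/
def rot (γ : Fin 3 → ℝ) (F : (Fin 3 → ℝ) → ℝ) (i : Fin 3) : ℝ := ∑ l, pdGam F l γ * skew γ i l

/-- The momenta `f 𝐒 M + C θ + c η`, where `f`, `θ`, `η` depend on `γ` and `C`, `c` are meant to be
Casimir functions. -/
def shiftedMom (b : Fin 3 → ℝ) (d : ℝ) (f : (Fin 3 → ℝ) → ℝ) (θ η : (Fin 3 → ℝ) → Fin 3 → ℝ)
    (C c : Phase → ℝ) (i : Fin 3) (y : Phase) : ℝ :=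
  f (gam y) * symSMom b d y i + (C y * θ (gam y) i + c y * η (gam y) i)

/-- The conditions at the phase point `x` under which `shiftedMom` has the canonical brackets. Here
`P l` and `Q l` stand for the logarithmic derivatives of `u` and of `s = det 𝐒`, and `T` for
`tr (adj 𝐒) / s`. The fields `gam_θ` and `gam_η` are the derivatives of `(γ, θ) = -f` and of
`(γ, η) = const`; `symSMom_Q` reflects `∇s = 4d (adj 𝐒 γ - tr (adj 𝐒) γ)`. -/
structure IsNormalForm (b : Fin 3 → ℝ) (d : ℝ) (u : Phase → ℝ) (p : Phase → Fin 3 → ℝ)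
    (f : (Fin 3 → ℝ) → ℝ) (θ η : (Fin 3 → ℝ) → Fin 3 → ℝ) (C c : Phase → ℝ)
    (P Q : Fin 3 → ℝ) (T : ℝ) (x : Phase) : Prop where
  diff_f : DifferentiableAt ℝ f (gam x)
  diff_θ : ∀ i, DifferentiableAt ℝ (fun γ => θ γ i) (gam x)
  diff_η : ∀ i, DifferentiableAt ℝ (fun γ => η γ i) (gam x)
  diff_C : DifferentiableAt ℝ C x
  diff_c : DifferentiableAt ℝ c x
  casimir_C : ∀ j, ∑ i, adjBivector b d u p x i j * pd C i x = 0
  casimir_c : ∀ j, ∑ i, adjBivector b d u p x i j * pd c i x = 0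
  f_eq : f (gam x) * (-1 / (2 * d) * u x * (symS b d (gam x)).det) = 1
  p_eq : ∀ l, p x l = u x * P l
  pd_f : ∀ l, pdGam f l (gam x) = -f (gam x) * (P l + Q l)
  gam_symSMom : ∑ i, gam x i * symSMom b d x i = C x
  symSMom_Q : ∑ i, symSMom b d x i * Q i = 4 * d * (gam x ⬝ᵥ mom x) - 4 * d * C x * T
  gam_θ : ∀ l, ∑ j, gam x j * pdGam (fun γ => θ γ j) l (gam x) + θ (gam x) l
    = -pdGam f l (gam x)
  div_θ : ∑ l, pdGam (fun γ => θ γ l) l (gam x) = -4 * d * f (gam x) * T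
  gam_η : ∀ l, ∑ j, gam x j * pdGam (fun γ => η γ j) l (gam x) + η (gam x) l = 0
  div_η : ∑ l, pdGam (fun γ => η γ l) l (gam x) = 0

section NormalForm

variable {b : Fin 3 → ℝ} {d : ℝ} {u : Phase → ℝ} {p : Phase → Fin 3 → ℝ} {f : (Fin 3 → ℝ) → ℝ}
  {θ η : (Fin 3 → ℝ) → Fin 3 → ℝ} {C c : Phase → ℝ} {P Q : Fin 3 → ℝ} {T : ℝ} {x : Phase}

theorem bracket_symSMom_gam (F : (Fin 3 → ℝ) → ℝ) (hF : DifferentiableAt ℝ F (gam x))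
    (j : Fin 3) :
    bracket (adjBivector b d u p) (fun y => symSMom b d y j) (fun y => F (gam y)) x
      = -1 / (2 * d) * u x * (symS b d (gam x)).det * rot (gam x) F j := by
  rw [bracket_swap fun i j => adjBivector_skew b d u p x i j,
    bracket_gam_symSMom _ _ _ _ _ F hF j, rot, ← mul_neg, ← Finset.sum_neg_distrib]
  congr 1
  refine Finset.sum_congr rfl fun l _ => ?_
  have h := congrFun (congrFun (skew_transpose (gam x)) j) l
  rw [Matrix.transpose_apply, Matrix.neg_apply] at h
  rw [h]
  ring

theorem differentiableAt_comp_gam {F : (Fin 3 → ℝ) → ℝ} (hF : DifferentiableAt ℝ F (gam x)) :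
    DifferentiableAt ℝ (fun y => F (gam y)) x :=
  hF.comp x differentiable_gam.differentiableAt

theorem IsNormalForm.bracket_shiftedMom_gam (H : IsNormalForm b d u p f θ η C c P Q T x)
    {F : (Fin 3 → ℝ) → ℝ} (hF : DifferentiableAt ℝ F (gam x)) (i : Fin 3) :
    bracket (adjBivector b d u p) (shiftedMom b d f θ η C c i) (fun y => F (gam y)) x
      = rot (gam x) F i := by
  have hf := differentiableAt_comp_gam H.diff_f
  have hθ := differentiableAt_comp_gam (H.diff_θ i)
  have hη := differentiableAt_comp_gam (H.diff_η i)
  have hμ := (differentiable_symSMom b d i).differentiableAt (x := x)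
  have hC := H.diff_C
  have hc := H.diff_c
  have h0 : ∀ {h}, bracket (adjBivector b d u p) C h x = 0 :=
    bracket_eq_zero_of_casimir H.casimir_C
  have h1 : ∀ {h}, bracket (adjBivector b d u p) c h x = 0 :=
    bracket_eq_zero_of_casimir H.casimir_c
  unfold shiftedMom
  rw [bracket_add_left (hf.fun_mul hμ) ((hC.fun_mul hθ).fun_add (hc.fun_mul hη)),
    bracket_add_left (hC.fun_mul hθ) (hc.fun_mul hη), bracket_mul_left hf hμ, bracket_mul_left hC hθ,
    bracket_mul_left hc hη, h0, h1, bracket_gam_gam _ _ _ _ _ f F H.diff_f,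
    bracket_gam_gam _ _ _ _ _ (fun γ => θ γ i) F (H.diff_θ i),
    bracket_gam_gam _ _ _ _ _ (fun γ => η γ i) F (H.diff_η i), bracket_symSMom_gam F hF]
  linear_combination rot (gam x) F i * H.f_eq

/-- The shift by multiples of Casimir functions gives the momenta the brackets of `so(3)`. -/
theorem IsNormalForm.bracket_shiftedMom_shiftedMom (H : IsNormalForm b d u p f θ η C c P Q T x)
    (k : Fin 3) :
    bracket (adjBivector b d u p) (shiftedMom b d f θ η C c (k + 1))
      (shiftedMom b d f θ η C c (k + 2)) x = shiftedMom b d f θ η C c k x := by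
  have hf := differentiableAt_comp_gam H.diff_f
  have hθ := fun i => differentiableAt_comp_gam (H.diff_θ i)
  have hη := fun i => differentiableAt_comp_gam (H.diff_η i)
  have hμ := fun i => (differentiable_symSMom b d i).differentiableAt (x := x)
  have hC := H.diff_C
  have hc := H.diff_c
  have hsw : ∀ f g, bracket (adjBivector b d u p) g f x = -bracket (adjBivector b d u p) f g x :=
    fun f g => bracket_swap fun i j => adjBivector_skew b d u p x i j
  have h0 : ∀ h, bracket (adjBivector b d u p) C h x = 0 := fun h =>
    bracket_eq_zero_of_casimir H.casimir_C
  have h1 : ∀ h, bracket (adjBivector b d u p) c h x = 0 := fun h =>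
    bracket_eq_zero_of_casimir H.casimir_c
  have h0' : ∀ h, bracket (adjBivector b d u p) h C x = 0 := fun h => by rw [hsw, h0, neg_zero]
  have h1' : ∀ h, bracket (adjBivector b d u p) h c x = 0 := fun h => by rw [hsw, h1, neg_zero]
  have e : ∀ j, bracket (adjBivector b d u p) (fun y => symSMom b d y (k + 1))
        (shiftedMom b d f θ η C c j) x
      = f (gam x) * bracket (adjBivector b d u p) (fun y => symSMom b d y (k + 1))
          (fun y => symSMom b d y j) x
        + -1 / (2 * d) * u x * (symS b d (gam x)).det *
          (symSMom b d x j * rot (gam x) f (k + 1)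
            + C x * rot (gam x) (fun γ => θ γ j) (k + 1)
            + c x * rot (gam x) (fun γ => η γ j) (k + 1)) := by
    intro j
    unfold shiftedMom
    rw [bracket_add_right (hf.fun_mul (hμ j)) ((hC.fun_mul (hθ j)).fun_add (hc.fun_mul (hη j))),
      bracket_add_right (hC.fun_mul (hθ j)) (hc.fun_mul (hη j)), bracket_mul_right hf (hμ j),
      bracket_mul_right hC (hθ j), bracket_mul_right hc (hη j), h0', h1',
      bracket_symSMom_gam f H.diff_f, bracket_symSMom_gam _ (H.diff_θ j),
      bracket_symSMom_gam _ (H.diff_η j)]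
    ring
  have e' : ∀ (F : (Fin 3 → ℝ) → ℝ) (j : Fin 3), DifferentiableAt ℝ F (gam x) →
      bracket (adjBivector b d u p) (fun y => F (gam y)) (shiftedMom b d f θ η C c j) x
        = -rot (gam x) F j := fun F j hF => by
    rw [hsw, H.bracket_shiftedMom_gam hF]
  have e1 : bracket (adjBivector b d u p) (shiftedMom b d f θ η C c (k + 1))
      (shiftedMom b d f θ η C c (k + 2)) x
      = f (gam x) * bracket (adjBivector b d u p) (fun y => symSMom b d y (k + 1))
          (shiftedMom b d f θ η C c (k + 2)) x
        - symSMom b d x (k + 1) * rot (gam x) f (k + 2)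
        - C x * rot (gam x) (fun γ => θ γ (k + 1)) (k + 2)
        - c x * rot (gam x) (fun γ => η γ (k + 1)) (k + 2) := by
    have h2 := e' f (k + 2) H.diff_f
    have h3 := e' (fun γ => θ γ (k + 1)) (k + 2) (H.diff_θ _)
    have h4 := e' (fun γ => η γ (k + 1)) (k + 2) (H.diff_η _)
    generalize shiftedMom b d f θ η C c (k + 2) = L at h2 h3 h4 ⊢
    unfold shiftedMom
    rw [bracket_add_left (hf.fun_mul (hμ _)) ((hC.fun_mul (hθ _)).fun_add (hc.fun_mul (hη _))),
      bracket_add_left (hC.fun_mul (hθ _)) (hc.fun_mul (hη _)), bracket_mul_left hf (hμ _),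
      bracket_mul_left hC (hθ _), bracket_mul_left hc (hη _), h0, h1, h2, h3, h4]
    ring
  rw [e1, e, bracket_symSMom_symSMom, shiftedMom]
  have hp : symSMom b d x ⬝ᵥ p x = u x * (symSMom b d x ⬝ᵥ P) := by
    simp only [dotProduct, Finset.mul_sum, H.p_eq]
    exact Finset.sum_congr rfl fun l _ => by ring
  -- by `∇f = -f (P + Q)` the brackets of the `f 𝐒 M` leave the error `C (-∇f + 4d f T γ)`, which
  -- the terms with `θ` cancel by the values of `div θ` and of the derivative of `(γ, θ)`
  have key : f (gam x) * (symSMom b d x k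
        + (4 * d * (gam x ⬝ᵥ mom x) + symSMom b d x ⬝ᵥ P) * gam x k)
      + symSMom b d x (k + 2) * rot (gam x) f (k + 1)
      - symSMom b d x (k + 1) * rot (gam x) f (k + 2)
      + C x * (rot (gam x) (fun γ => θ γ (k + 2)) (k + 1)
        - rot (gam x) (fun γ => θ γ (k + 1)) (k + 2))
      + c x * (rot (gam x) (fun γ => η γ (k + 2)) (k + 1)
        - rot (gam x) (fun γ => η γ (k + 1)) (k + 2))
      = f (gam x) * symSMom b d x k + (C x * θ (gam x) k + c x * η (gam x) k) := by
    have hDf := H.pd_f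
    have hCμ := H.gam_symSMom
    have hμQ := H.symSMom_Q
    have hθl := H.gam_θ k
    have hdθ := H.div_θ
    have hηl := H.gam_η k
    have hdη := H.div_η
    simp only [dotProduct, Fin.sum_univ_three, rot] at hCμ hμQ hθl hdθ hηl hdη ⊢
    fin_cases k <;>
      simp only [skew, Matrix.of_apply, Matrix.cons_val, Fin.isValue, Fin.zero_eta, Fin.mk_one,
        Fin.reduceFinMk, Fin.reduceAdd, zero_add] at hθl hηl ⊢
    · linear_combination -pdGam f 0 (gam x) * hCμ + gam x 0 * (symSMom b d x 0 * hDf 0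
        + symSMom b d x 1 * hDf 1 + symSMom b d x 2 * hDf 2) - f (gam x) * gam x 0 * hμQ
        - C x * hθl + C x * gam x 0 * hdθ - c x * hηl + c x * gam x 0 * hdη
    · linear_combination -pdGam f 1 (gam x) * hCμ + gam x 1 * (symSMom b d x 0 * hDf 0
        + symSMom b d x 1 * hDf 1 + symSMom b d x 2 * hDf 2) - f (gam x) * gam x 1 * hμQ
        - C x * hθl + C x * gam x 1 * hdθ - c x * hηl + c x * gam x 1 * hdη
    · linear_combination -pdGam f 2 (gam x) * hCμ + gam x 2 * (symSMom b d x 0 * hDf 0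
        + symSMom b d x 1 * hDf 1 + symSMom b d x 2 * hDf 2) - f (gam x) * gam x 2 * hμQ
        - C x * hθl + C x * gam x 2 * hdθ - c x * hηl + c x * gam x 2 * hdη
  linear_combination key + (f (gam x) * (symSMom b d x k
        + (4 * d * (gam x ⬝ᵥ mom x) + symSMom b d x ⬝ᵥ P) * gam x k)
      + symSMom b d x (k + 2) * rot (gam x) f (k + 1)
      + C x * rot (gam x) (fun γ => θ γ (k + 2)) (k + 1)
      + c x * rot (gam x) (fun γ => η γ (k + 2)) (k + 1)) * H.f_eq
    + f (gam x) ^ 2 * (-1 / (2 * d) * (symS b d (gam x)).det) * gam x k * hp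

end NormalForm

/-! ### The change of variables in normal form -/

theorem sFun_eq_det (I : Fin 3 → ℝ) (d : ℝ) (γ : Fin 3 → ℝ) :
    sFun I d γ = (symS (bCoef I d) d γ).det := by
  simp only [sFun, symS, Matrix.det_fin_three, dotProduct, Fin.sum_univ_three, Matrix.of_apply,
    Matrix.cons_val]
  ring

/-- The factor of `𝐒 M` in the new momenta. -/
def factorS (I : Fin 3 → ℝ) (d : ℝ) (γ : Fin 3 → ℝ) : ℝ := -2 * d * (g I d γ * sFun I d γ)⁻¹

/-- The common factor `1 / (g s b₁ b₂ ρ)` of the change of variables. -/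
def factorN (I : Fin 3 → ℝ) (d : ℝ) (γ : Fin 3 → ℝ) : ℝ :=
  1 / (g I d γ * sFun I d γ * bCoef I d 0 * bCoef I d 1 * (γ 0 ^ 2 + γ 1 ^ 2))

/-- The vector of polynomials with `A m + β M₃ = -2 d b₁ b₂ ρ 𝐒 M + C₂ v`. -/
def shiftNum (b : Fin 3 → ℝ) (d : ℝ) (γ : Fin 3 → ℝ) : Fin 3 → ℝ :=
  ![-2 * d * γ 0 * (2 * d * (γ 1 ^ 2 * (b 1 - b 0) + b 1 * γ 2 ^ 2) - b 0 * b 1),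
    -2 * d * γ 1 * (2 * d * (γ 0 ^ 2 * (b 0 - b 1) + b 0 * γ 2 ^ 2) - b 0 * b 1),
    4 * d ^ 2 * γ 2 * (b 0 * γ 1 ^ 2 + b 1 * γ 0 ^ 2)]

/-- The vector field `(γ₁, γ₂, 0) / ρ`. -/
def axisField (γ : Fin 3 → ℝ) : Fin 3 → ℝ :=
  ![γ 0 / (γ 0 ^ 2 + γ 1 ^ 2), γ 1 / (γ 0 ^ 2 + γ 1 ^ 2), 0]

/-- The coefficient of `C₂` in the new momenta, for `K = h / (g s b₁ b₂ ρ)`. -/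
def shiftField (I : Fin 3 → ℝ) (d : ℝ) (K : (Fin 3 → ℝ) → ℝ) (γ : Fin 3 → ℝ) (i : Fin 3) : ℝ :=
  factorN I d γ * shiftNum (bCoef I d) d γ i + K γ * meridianField γ i

/-- The new momenta are of the form `f 𝐒 M + C₂ θ + c η`. -/
theorem newMom_eq {I : Fin 3 → ℝ} {d : ℝ} (hb0 : bCoef I d 0 ≠ 0) (hb1 : bCoef I d 1 ≠ 0)
    {x : Phase} (hx : gam x ∈ goodGamma I d) (h : (Fin 3 → ℝ) → ℝ) (c : ℝ) (i : Fin 3) :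
    newMom I d h c x i = factorS I d (gam x) * symSMom (bCoef I d) d x i
      + (C2 I d x * shiftField I d (fun γ => factorN I d γ * h γ) (gam x) i
        + c * axisField (gam x) i) := by
  obtain ⟨hg, hs, hρ⟩ := hx
  have hg := (g_pos hg).ne'
  simp only [factorS, shiftField, factorN, newMom, C2]
  generalize g I d (gam x) = g0 at *
  generalize sFun I d (gam x) = s0 at *
  simp only [axisField, meridianField, symSMom, shiftNum, alphaL, betaL, symS, Matrix.mulVec,
    dotProduct, Fin.sum_univ_three]
  fin_cases i <;>
    (simp only [Matrix.of_apply, Matrix.cons_val, Fin.isValue, Fin.zero_eta, Fin.mk_one,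
      Fin.reduceFinMk]
     field_simp
     ring)

section PdGam

variable {F F' : (Fin 3 → ℝ) → ℝ} {γ : Fin 3 → ℝ} (l : Fin 3)

theorem pdGam_const (c : ℝ) : pdGam (fun _ => c) l γ = 0 := by simp [pdGam]

theorem pdGam_coord (i : Fin 3) : pdGam (fun γ => γ i) l γ = if i = l then 1 else 0 := by
  have h : HasFDerivAt (fun y : Fin 3 → ℝ => y i)
      (ContinuousLinearMap.proj (R := ℝ) (φ := fun _ : Fin 3 => ℝ) i) γ := hasFDerivAt_apply i γ
  simp [pdGam, h.fderiv, Pi.single_apply]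

theorem pdGam_add (hF : DifferentiableAt ℝ F γ) (hF' : DifferentiableAt ℝ F' γ) :
    pdGam (fun y => F y + F' y) l γ = pdGam F l γ + pdGam F' l γ := by
  simp [pdGam, fderiv_fun_add hF hF']

theorem pdGam_mul (hF : DifferentiableAt ℝ F γ) (hF' : DifferentiableAt ℝ F' γ) :
    pdGam (fun y => F y * F' y) l γ = F γ * pdGam F' l γ + F' γ * pdGam F l γ := by
  simp [pdGam, fderiv_fun_mul hF hF']

theorem pdGam_pow (n : ℕ) (hF : DifferentiableAt ℝ F γ) :
    pdGam (fun y => F y ^ n) l γ = n * F γ ^ (n - 1) * pdGam F l γ := by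
  simp [pdGam, fderiv_fun_pow n hF]

theorem pdGam_inv (hF : DifferentiableAt ℝ F γ) (h : F γ ≠ 0) :
    pdGam (fun y => (F y)⁻¹) l γ = -(F γ ^ 2)⁻¹ * pdGam F l γ := by
  have h1 := (hasDerivAt_inv h).comp_hasFDerivAt γ hF.hasFDerivAt
  have h2 : HasFDerivAt (fun y => (F y)⁻¹) (-(F γ ^ 2)⁻¹ • fderiv ℝ F γ) γ := h1
  simp [pdGam, h2.fderiv]

theorem sum_mul_pdGam (v : Fin 3 → ℝ) : ∑ l, v l * pdGam F l γ = fderiv ℝ F γ v := by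
  conv_rhs => rw [pi_eq_sum_univ' v]
  simp only [map_sum, map_smul, smul_eq_mul, pdGam]

end PdGam

theorem contDiff_sFun (I : Fin 3 → ℝ) (d : ℝ) : ContDiff ℝ ∞ (sFun I d) := by
  unfold sFun dotProduct
  fun_prop

theorem contDiff_shiftNum (b : Fin 3 → ℝ) (d : ℝ) (i : Fin 3) :
    ContDiff ℝ ∞ fun γ => shiftNum b d γ i := by
  fin_cases i <;> simp [shiftNum] <;> fun_prop

section Good

variable {I : Fin 3 → ℝ} {d : ℝ} {γ : Fin 3 → ℝ}

theorem contDiffAt_g (hγ : 0 < gSq I d γ) : ContDiffAt ℝ ∞ (g I d) γ :=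
  (contDiff_gSq I d).contDiffAt.sqrt hγ.ne'

theorem contDiffAt_factorS (hγ : γ ∈ goodGamma I d) : ContDiffAt ℝ ∞ (factorS I d) γ :=
  contDiffAt_const.mul (((contDiffAt_g hγ.1).mul (contDiff_sFun I d).contDiffAt).inv
    (mul_ne_zero (g_pos hγ.1).ne' hγ.2.1))

theorem contDiffAt_factorN (hb0 : bCoef I d 0 ≠ 0) (hb1 : bCoef I d 1 ≠ 0)
    (hγ : γ ∈ goodGamma I d) : ContDiffAt ℝ ∞ (factorN I d) γ := by
  have h1 := contDiffAt_g hγ.1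
  have h2 := (contDiff_sFun I d).contDiffAt (x := γ)
  unfold factorN
  refine ContDiffAt.div contDiffAt_const (by fun_prop) ?_
  have := (g_pos hγ.1).ne'
  have := hγ.2.1
  have := hγ.2.2
  positivity

theorem contDiffAt_meridianField (hγ : γ 0 ^ 2 + γ 1 ^ 2 ≠ 0) (i : Fin 3) :
    ContDiffAt ℝ ∞ (fun γ => meridianField γ i) γ := by
  fin_cases i
  · exact ContDiffAt.div (f := fun γ : Fin 3 → ℝ => γ 0 * γ 2) (by fun_prop) (by fun_prop) hγ
  · exact ContDiffAt.div (f := fun γ : Fin 3 → ℝ => γ 1 * γ 2) (by fun_prop) (by fun_prop) hγ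
  · exact contDiffAt_const

theorem contDiffAt_axisField (hγ : γ 0 ^ 2 + γ 1 ^ 2 ≠ 0) (i : Fin 3) :
    ContDiffAt ℝ ∞ (fun γ => axisField γ i) γ := by
  fin_cases i
  · exact ContDiffAt.div (f := fun γ : Fin 3 → ℝ => γ 0) (by fun_prop) (by fun_prop) hγ
  · exact ContDiffAt.div (f := fun γ : Fin 3 → ℝ => γ 1) (by fun_prop) (by fun_prop) hγ
  · exact contDiffAt_const

theorem pdGam_axisField (hγ : γ 0 ^ 2 + γ 1 ^ 2 ≠ 0) (i l : Fin 3) :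
    pdGam (fun γ => axisField γ i) l γ
      = if i = 2 then 0 else (γ 0 ^ 2 + γ 1 ^ 2)⁻¹ * (if i = l then 1 else 0)
        - γ i * (γ 0 ^ 2 + γ 1 ^ 2)⁻¹ ^ 2 * (if l = 2 then 0 else 2 * γ l) := by
  have hd : DifferentiableAt ℝ (fun γ : Fin 3 → ℝ => γ 0 ^ 2 + γ 1 ^ 2) γ := by fun_prop
  have hdi : DifferentiableAt ℝ (fun γ : Fin 3 → ℝ => (γ 0 ^ 2 + γ 1 ^ 2)⁻¹) γ := hd.inv hγ
  have h : pdGam (fun γ : Fin 3 → ℝ => γ 0 ^ 2 + γ 1 ^ 2) l γ = if l = 2 then 0 else 2 * γ l := by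
    simp (disch := fun_prop) only [pdGam_add, pdGam_pow, pdGam_coord]
    fin_cases l <;> simp
  have key : ∀ j : Fin 3, pdGam (fun γ => γ j / (γ 0 ^ 2 + γ 1 ^ 2)) l γ
      = (γ 0 ^ 2 + γ 1 ^ 2)⁻¹ * (if j = l then 1 else 0)
        - γ j * (γ 0 ^ 2 + γ 1 ^ 2)⁻¹ ^ 2 * (if l = 2 then 0 else 2 * γ l) := by
    intro j
    simp only [div_eq_mul_inv]
    rw [pdGam_mul _ (by fun_prop) hdi, pdGam_inv _ hd hγ, h, pdGam_coord, inv_pow]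
    ring
  fin_cases i
  · exact key 0
  · exact key 1
  · exact pdGam_const l 0

theorem div_axisField (hγ : γ 0 ^ 2 + γ 1 ^ 2 ≠ 0) :
    ∑ l, pdGam (fun γ => axisField γ l) l γ = 0 := by
  simp only [pdGam_axisField hγ, Fin.sum_univ_three]
  simp
  field_simp
  ring

theorem gam_axisField (hγ : γ 0 ^ 2 + γ 1 ^ 2 ≠ 0) (l : Fin 3) :
    ∑ j, γ j * pdGam (fun γ => axisField γ j) l γ + axisField γ l = 0 := by
  simp only [pdGam_axisField hγ, Fin.sum_univ_three]
  fin_cases l <;> simp [axisField] <;> field_simp <;> ring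

theorem div_meridianField (hγ : γ 0 ^ 2 + γ 1 ^ 2 ≠ 0) :
    ∑ l, pdGam (fun γ => meridianField γ l) l γ = 0 := by
  have h0 : (fun γ => meridianField γ 0) = fun γ => γ 2 * axisField γ 0 := by
    ext γ; simp only [meridianField, axisField, Matrix.cons_val]; ring
  have h1 : (fun γ => meridianField γ 1) = fun γ => γ 2 * axisField γ 1 := by
    ext γ; simp only [meridianField, axisField, Matrix.cons_val]; ring
  have h2 : (fun γ => meridianField γ 2) = fun _ => -1 := rfl
  have hd := fun i => (contDiffAt_axisField hγ i).differentiableAt (by simp)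
  rw [Fin.sum_univ_three, h0, h1, h2, pdGam_mul _ (by fun_prop) (hd 0),
    pdGam_mul _ (by fun_prop) (hd 1), pdGam_const]
  have h := div_axisField hγ
  have h3 : pdGam (fun γ => axisField γ 2) 2 γ = 0 := pdGam_const 2 0
  rw [Fin.sum_univ_three, h3] at h
  simp only [pdGam_coord]
  simp
  linear_combination γ 2 * h

end Good

theorem pdGam_sFun (I : Fin 3 → ℝ) (d : ℝ) (γ : Fin 3 → ℝ) (l : Fin 3) :
    pdGam (sFun I d) l γ = 4 * d * ((adjS (bCoef I d) d γ *ᵥ γ) l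
      - (adjS (bCoef I d) d γ).trace * γ l) := by
  -- the derivative is computed by the rules for `pd`, at a phase point above `γ`
  have h := pd_comp_gam_inl (x := Sum.elim γ 0)
    ((contDiff_sFun I d).contDiffAt.differentiableAt (by simp)) l
  have hγ : gam (Sum.elim γ 0) = γ := rfl
  rw [hγ] at h
  rw [← h]
  simp only [sFun_eq_det]
  fin_cases l <;>
    (simp (disch := fun_prop) [Matrix.det_fin_three, symS, adjS, Matrix.adjugate_fin_three,
      Matrix.trace, Matrix.mulVec, dotProduct, Fin.sum_univ_three, gam, pd_add, pd_sub, pd_mul,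
      pd_pow, pd_const, pd_coord]
     ring)

theorem adjS_mulVec (b : Fin 3 → ℝ) (d : ℝ) (γ : Fin 3 → ℝ) (M : Fin 3 → ℝ) :
    (symS b d γ *ᵥ M) ⬝ᵥ (adjS b d γ *ᵥ γ) = (symS b d γ).det * (γ ⬝ᵥ M) := by
  simp only [symS, adjS, Matrix.adjugate_fin_three, Matrix.det_fin_three, Matrix.mulVec,
    dotProduct, Fin.sum_univ_three, Matrix.of_apply, Matrix.cons_val]
  ring

theorem gam_symSMom (I : Fin 3 → ℝ) (d : ℝ) (x : Phase) :
    ∑ i, gam x i * symSMom (bCoef I d) d x i = C2 I d x := by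
  simp only [symSMom, symS, C2, Matrix.mulVec, dotProduct, Fin.sum_univ_three, Matrix.of_apply,
    Matrix.cons_val]
  ring

/-! ### The function `h` and the brackets of the new momenta -/

theorem contDiffAt_pdGam {F : (Fin 3 → ℝ) → ℝ} {γ : Fin 3 → ℝ} (hF : ContDiffAt ℝ ∞ F γ)
    (l : Fin 3) : ContDiffAt ℝ ∞ (pdGam F l) γ :=
  (hF.fderiv_right (m := ∞) (by simp)).clm_apply contDiffAt_const

/-- The function `tr (adj 𝐒) / s`, in terms of which the divergence of `shiftField` is prescribed. -/
def traceRatio (I : Fin 3 → ℝ) (d : ℝ) (γ : Fin 3 → ℝ) : ℝ :=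
  (adjS (bCoef I d) d γ).trace / sFun I d γ

/-- The divergence of `shiftField` can be prescribed by solving a differential equation along the
meridians. -/
theorem exists_div_shiftField {I : Fin 3 → ℝ} {d : ℝ} (hb0 : bCoef I d 0 ≠ 0)
    (hb1 : bCoef I d 1 ≠ 0) {V : Set (Fin 3 → ℝ)} (hV : IsOpen V) (hsub : V ⊆ goodGamma I d)
    (hconn : ∀ γ ∈ V, IsPreconnected (V ∩ meridian γ)) :
    ∃ K : (Fin 3 → ℝ) → ℝ, ContDiffOn ℝ ∞ K V ∧ ∀ γ ∈ V,
      ∑ l, pdGam (fun γ => shiftField I d K γ l) l γ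
        = -4 * d * factorS I d γ * traceRatio I d γ := by
  have hv : ∀ γ ∈ V, ∀ l,
      ContDiffAt ℝ ∞ (fun γ => factorN I d γ * shiftNum (bCoef I d) d γ l) γ := fun γ hγ l =>
    (contDiffAt_factorN hb0 hb1 (hsub hγ)).mul (contDiff_shiftNum _ d l).contDiffAt
  obtain ⟨K, hK, hKd⟩ := exists_meridian_antideriv hV (fun γ hγ => (hsub hγ).2.2) hconn
    (G := fun γ => -4 * d * factorS I d γ * traceRatio I d γ
      - ∑ l, pdGam (fun γ => factorN I d γ * shiftNum (bCoef I d) d γ l) l γ) (by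
    intro γ hγ
    refine ContDiffAt.contDiffWithinAt (ContDiffAt.sub ?_ (ContDiffAt.sum fun l _ =>
      contDiffAt_pdGam (hv γ hγ l) l))
    have h1 := contDiffAt_factorS (hsub hγ)
    have h2 : ContDiffAt ℝ ∞ (traceRatio I d) γ := by
      refine ContDiffAt.div ?_ (contDiff_sFun I d).contDiffAt (hsub hγ).2.1
      exact ContDiffAt.sum fun i _ => (contDiff_adjS _ d i i).contDiffAt
    fun_prop)
  refine ⟨K, hK, fun γ hγ => ?_⟩
  have hKγ := (hK.contDiffAt (hV.mem_nhds hγ)).differentiableAt (by simp)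
  have hw := fun l => (contDiffAt_meridianField (hsub hγ).2.2 l).differentiableAt (by simp)
  have e : ∀ l, pdGam (fun γ => shiftField I d K γ l) l γ
      = pdGam (fun γ => factorN I d γ * shiftNum (bCoef I d) d γ l) l γ
        + (K γ * pdGam (fun γ => meridianField γ l) l γ + meridianField γ l * pdGam K l γ) := by
    intro l
    unfold shiftField
    rw [pdGam_add _ ((hv γ hγ l).differentiableAt (by simp)) (hKγ.fun_mul (hw l)),
      pdGam_mul _ hKγ (hw l)]
  simp only [e, Finset.sum_add_distrib]
  rw [← Finset.mul_sum, div_meridianField (hsub hγ).2.2, sum_mul_pdGam, hKd γ hγ]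
  ring

section

variable {I : Fin 3 → ℝ} {d : ℝ} {V : Set (Fin 3 → ℝ)} {K : (Fin 3 → ℝ) → ℝ}

theorem differentiableAt_shiftField (hb0 : bCoef I d 0 ≠ 0) (hb1 : bCoef I d 1 ≠ 0)
    {γ : Fin 3 → ℝ} (hγ : γ ∈ goodGamma I d) (hK : DifferentiableAt ℝ K γ) (i : Fin 3) :
    DifferentiableAt ℝ (fun γ => shiftField I d K γ i) γ := by
  have h1 := (contDiffAt_factorN hb0 hb1 hγ).differentiableAt (by simp)
  have h2 := ((contDiff_shiftNum (bCoef I d) d i).contDiffAt (x := γ)).differentiableAt (by simp)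
  have h3 := (contDiffAt_meridianField hγ.2.2 i).differentiableAt (by simp)
  unfold shiftField
  fun_prop

theorem gam_shiftField (hb0 : bCoef I d 0 ≠ 0) (hb1 : bCoef I d 1 ≠ 0) {γ : Fin 3 → ℝ}
    (hγ : γ ∈ goodGamma I d) : ∑ i, γ i * shiftField I d K γ i = -factorS I d γ := by
  obtain ⟨hg, hs, hρ⟩ := hγ
  have hg := (g_pos hg).ne'
  simp only [shiftField, factorN, factorS, shiftNum, meridianField, Fin.sum_univ_three,
    Matrix.cons_val]
  generalize g I d γ = g0 at *
  generalize sFun I d γ = s0 at *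
  field_simp
  ring

theorem sum_gam_axisField {γ : Fin 3 → ℝ} (hγ : γ 0 ^ 2 + γ 1 ^ 2 ≠ 0) :
    ∑ i, γ i * axisField γ i = 1 := by
  simp only [axisField, Fin.sum_univ_three, Matrix.cons_val]
  field_simp
  ring

theorem isNormalForm_newMom (hd : 0 < d) (hb0 : bCoef I d 0 ≠ 0) (hb1 : bCoef I d 1 ≠ 0)
    (hV : IsOpen V) (hsub : V ⊆ goodGamma I d) (hK : ContDiffOn ℝ ∞ K V)
    (hdiv : ∀ γ ∈ V, ∑ l, pdGam (fun γ => shiftField I d K γ l) l γ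
        = -4 * d * factorS I d γ * traceRatio I d γ) {x : Phase} (hx : gam x ∈ V) {c : Phase → ℝ}
    (hc : DifferentiableAt ℝ c x)
    (hcc : ∀ j, ∑ i, adjBivector (bCoef I d) d (fun x => g I d (gam x))
      (fun x => gradG I d (gam x)) x i j * pd c i x = 0) :
    IsNormalForm (bCoef I d) d (fun x => g I d (gam x)) (fun x => gradG I d (gam x))
      (factorS I d) (shiftField I d K) axisField (C2 I d) c
      (fun l => gradG I d (gam x) l / g I d (gam x))
      (fun l => pdGam (sFun I d) l (gam x) / sFun I d (gam x)) (traceRatio I d (gam x)) x := by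
  have hgood := hsub hx
  have hKx := (hK.contDiffAt (hV.mem_nhds hx)).differentiableAt (by simp)
  have hg := (g_pos hgood.1).ne'
  have hs := hgood.2.1
  have hθ := differentiableAt_shiftField hb0 hb1 hgood hKx
  refine ⟨(contDiffAt_factorS hgood).differentiableAt (by simp), hθ,
    fun i => (contDiffAt_axisField hgood.2.2 i).differentiableAt (by simp), ?_, hc,
    casimir_gamBMom _ _ _ _ _, hcc, ?_, fun l => ?_, fun l => ?_, gam_symSMom I d x, ?_,
    fun l => ?_, hdiv _ hx, gam_axisField hgood.2.2, div_axisField hgood.2.2⟩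
  · unfold C2 gam mom
    fun_prop
  · simp only [← sFun_eq_det, factorS]
    field_simp
  · field_simp
  · have h1 : pdGam (g I d) l (gam x) = gradG I d (gam x) l := by
      rw [← pd_comp_gam_inl ((contDiffAt_g hgood.1).differentiableAt (by simp)), pd_g_inl hgood.1]
    have h2 := (contDiffAt_g hgood.1).differentiableAt (by simp)
    have h3 := ((contDiff_sFun I d).contDiffAt (x := gam x)).differentiableAt (by simp)
    have h4 : DifferentiableAt ℝ (fun γ => (g I d γ * sFun I d γ)⁻¹) (gam x) :=
      (h2.fun_mul h3).inv (mul_ne_zero hg hs)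
    unfold factorS
    rw [pdGam_mul _ (by fun_prop) h4,
      pdGam_inv _ (h2.fun_mul h3) (mul_ne_zero hg hs), pdGam_mul _ h2 h3, pdGam_const, h1]
    field_simp
    ring
  · have h1 := adjS_mulVec (bCoef I d) d (gam x) (mom x)
    have h2 := gam_symSMom I d x
    simp only [pdGam_sFun, traceRatio, symSMom, sFun_eq_det, dotProduct, Fin.sum_univ_three]
      at h1 h2 hs ⊢
    field_simp
    linear_combination h1 - (adjS (bCoef I d) d (gam x)).trace * h2
  · have h1 : pdGam (fun γ => ∑ i, γ i * shiftField I d K γ i) l (gam x)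
        = pdGam (fun γ => -1 * factorS I d γ) l (gam x) := by
      have : (fun γ => ∑ i, γ i * shiftField I d K γ i) =ᶠ[nhds (gam x)]
          fun γ => -1 * factorS I d γ := by
        filter_upwards [hV.mem_nhds hx] with γ hγ
        rw [gam_shiftField hb0 hb1 (hsub hγ), neg_one_mul]
      simp only [pdGam, this.fderiv_eq]
    rw [pdGam_mul _ (by fun_prop) ((contDiffAt_factorS hgood).differentiableAt (by simp)),
      pdGam_const] at h1
    simp only [Fin.sum_univ_three] at h1 ⊢
    have hc : ∀ i, DifferentiableAt ℝ (fun γ : Fin 3 → ℝ => γ i) (gam x) := fun i => by fun_prop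
    rw [pdGam_add _ (((hc 0).fun_mul (hθ 0)).fun_add ((hc 1).fun_mul (hθ 1)))
      ((hc 2).fun_mul (hθ 2)), pdGam_add _ ((hc 0).fun_mul (hθ 0)) ((hc 1).fun_mul (hθ 1)),
      pdGam_mul _ (hc 0) (hθ 0), pdGam_mul _ (hc 1) (hθ 1), pdGam_mul _ (hc 2) (hθ 2)] at h1
    simp only [pdGam_coord] at h1
    fin_cases l <;> simp at h1 ⊢ <;> linarith

end

section

variable {I : Fin 3 → ℝ} {d : ℝ} {V : Set (Fin 3 → ℝ)} {K : (Fin 3 → ℝ) → ℝ}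

theorem factorN_ne_zero (hb0 : bCoef I d 0 ≠ 0) (hb1 : bCoef I d 1 ≠ 0) {γ : Fin 3 → ℝ}
    (hγ : γ ∈ goodGamma I d) : factorN I d γ ≠ 0 := by
  have := (g_pos hγ.1).ne'
  have := hγ.2.1
  have := hγ.2.2
  unfold factorN
  positivity

/-- The new momenta, with `h` expressed by the coefficient `K` of the meridian field. -/
theorem newMom_eq_shifted (hb0 : bCoef I d 0 ≠ 0) (hb1 : bCoef I d 1 ≠ 0)
    {x : Phase} (hx : gam x ∈ goodGamma I d) (c : ℝ) (i : Fin 3) :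
    newMom I d (fun γ => K γ / factorN I d γ) c x i
      = factorS I d (gam x) * symSMom (bCoef I d) d x i
      + (C2 I d x * shiftField I d K (gam x) i + c * axisField (gam x) i) := by
  rw [newMom_eq hb0 hb1 hx]
  simp only [shiftField, mul_div_cancel₀ _ (factorN_ne_zero hb0 hb1 hx)]

theorem gam_newMom (hb0 : bCoef I d 0 ≠ 0) (hb1 : bCoef I d 1 ≠ 0)
    {x : Phase} (hx : gam x ∈ goodGamma I d) (c : ℝ) :
    gam x ⬝ᵥ newMom I d (fun γ => K γ / factorN I d γ) c x = c := by
  have h1 := gam_symSMom I d x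
  have h2 := gam_shiftField (K := K) hb0 hb1 hx
  have h3 := sum_gam_axisField hx.2.2
  simp only [dotProduct, newMom_eq_shifted hb0 hb1 hx, Fin.sum_univ_three] at h1 h2 h3 ⊢
  linear_combination factorS I d (gam x) * h1 + C2 I d x * h2 + c * h3

theorem gam_dotProduct_pos {γ : Fin 3 → ℝ} (hγ : γ 0 ^ 2 + γ 1 ^ 2 ≠ 0) : 0 < γ ⬝ᵥ γ := by
  have h : 0 < γ 0 ^ 2 + γ 1 ^ 2 := lt_of_le_of_ne (by positivity) hγ.symm
  simp only [dotProduct, Fin.sum_univ_three]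
  nlinarith [sq_nonneg (γ 2)]

theorem contDiff_C2 (I : Fin 3 → ℝ) (d : ℝ) : ContDiff ℝ ∞ (C2 I d) := by
  unfold C2 gam mom
  fun_prop

theorem contDiff_gam_dotProduct : ContDiff ℝ ∞ fun x : Phase => gam x ⬝ᵥ gam x := by
  unfold gam dotProduct
  fun_prop

theorem contDiffAt_casimirs {φ : ℝ → ℝ → ℝ}
    (hφ : ContDiffOn ℝ ∞ (fun p : ℝ × ℝ => φ p.1 p.2) (Set.Ioi 0 ×ˢ Set.univ)) {t y : ℝ}
    (ht : 0 < t) : ContDiffAt ℝ ∞ (fun p : ℝ × ℝ => φ p.1 p.2) (t, y) :=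
  hφ.contDiffAt ((isOpen_Ioi.prod isOpen_univ).mem_nhds ⟨ht, trivial⟩)

theorem takesTo_changeOfVariables (hI : ∀ i, 0 < I i) (hd : 0 < d) (hb0 : bCoef I d 0 ≠ 0)
    (hb1 : bCoef I d 1 ≠ 0) (hV : IsOpen V) (hsub : V ⊆ goodGamma I d)
    (hK : ContDiffOn ℝ ∞ K V)
    (hdiv : ∀ γ ∈ V, ∑ l, pdGam (fun γ => shiftField I d K γ l) l γ
        = -4 * d * factorS I d γ * traceRatio I d γ) {φ : ℝ → ℝ → ℝ}
    (hφ : ContDiffOn ℝ ∞ (fun p : ℝ × ℝ => φ p.1 p.2) (Set.Ioi 0 ×ˢ Set.univ)) :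
    TakesTo (changeOfVariables I d (fun γ => K γ / factorN I d γ) φ) (Pb I d) canonicalP
      {x | gam x ∈ V} := by
  intro x hx
  rw [Pb_eq_adjBivector hI hd]
  have hgood := hsub hx
  let c : Phase → ℝ := fun y => φ (gam y ⬝ᵥ gam y) (C2 I d y)
  have hφx := (contDiffAt_casimirs hφ (y := C2 I d x)
    (gam_dotProduct_pos hgood.2.2)).differentiableAt (by simp)
  have hsq := (contDiff_gam_dotProduct.contDiffAt (x := x)).differentiableAt (by simp)
  have hC2 := ((contDiff_C2 I d).contDiffAt (x := x)).differentiableAt (by simp)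
  have hcd : DifferentiableAt ℝ c x :=
    DifferentiableAt.comp x (f := fun y => (gam y ⬝ᵥ gam y, C2 I d y)) hφx (hsq.prodMk hC2)
  have H := isNormalForm_newMom hd hb0 hb1 hV hsub hK hdiv hx hcd
    (casimir_comp (φ := fun p : ℝ × ℝ => φ p.1 p.2) hφx hsq hC2 (casimir_gamSq _ _ _ _ _)
      (casimir_gamBMom _ _ _ _ _))
  set L := shiftedMom (bCoef I d) d (factorS I d) (shiftField I d K) axisField (C2 I d) c with hL
  set F := changeOfVariables I d (fun γ => K γ / factorN I d γ) φ with hF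
  set Q := adjBivector (bCoef I d) d (fun x => g I d (gam x)) (fun x => gradG I d (gam x))
  have hFL : ∀ y, gam y ∈ V → ∀ i, F y (.inr i) = L i y := fun y hy i =>
    newMom_eq_shifted hb0 hb1 (hsub hy) _ i
  have hev : ∀ i, (fun y => F y (.inr i)) =ᶠ[nhds x] L i := fun i => by
    filter_upwards [(hV.preimage contDiff_gam.continuous).mem_nhds hx] with y hy
    exact hFL y hy i
  have hcoord : ∀ j, DifferentiableAt ℝ (fun γ : Fin 3 → ℝ => γ j) (gam x) := fun j => by fun_prop
  have hrot : ∀ i j, rot (gam x) (fun γ => γ j) i = skew (gam x) i j := fun i j => by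
    simp [rot, pdGam_coord]
  have hLg : ∀ i j, bracket Q (fun y => F y (.inr i)) (fun y => F y (.inl j)) x
      = skew (gam x) i j := fun i j => by
    rw [bracket_congr (hev i) Filter.EventuallyEq.rfl, ← hrot i j]
    exact H.bracket_shiftedMom_gam (hcoord j) i
  have hLL : ∀ k, bracket Q (fun y => F y (.inr (k + 1))) (fun y => F y (.inr (k + 2))) x
      = mom (F x) k := fun k => by
    rw [bracket_congr (hev _) (hev _)]
    exact (H.bracket_shiftedMom_shiftedMom k).trans (hFL x hx k).symm
  have hsw : ∀ f g, bracket Q g f x = -bracket Q f g x :=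
    fun f g => bracket_swap fun i j => adjBivector_skew _ _ _ _ x i j
  have hself : ∀ f, bracket Q f f x = 0 := fun f => by linarith [hsw f f]
  have hsk : ∀ i j, skew (gam x) j i = -skew (gam x) i j := fun i j =>
    congrFun (congrFun (skew_transpose (gam x)) i) j
  rintro (i | i) (j | j)
  · exact bracket_gam_gam _ _ _ _ _ (fun γ => γ i) (fun γ => γ j) (hcoord i)
  · rw [hsw, hLg]
    exact (hsk i j).symm ▸ neg_neg _
  · rw [hLg]
    show skew (gam x) i j = -skew (gam x) j i
    rw [hsk i j, neg_neg]
  · show _ = skew (mom (F x)) i j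
    have h0 := hLL 0
    have h1 := hLL 1
    have h2 := hLL 2
    simp only [zero_add, Fin.isValue, Fin.reduceAdd] at h0 h1 h2
    fin_cases i <;> fin_cases j <;>
      simp only [Fin.zero_eta, Fin.mk_one, Fin.reduceFinMk, skew, Matrix.of_apply,
        Matrix.cons_val, Fin.isValue]
    · exact hself _
    · exact h2
    · rw [hsw, h1]
    · rw [hsw, h2]
    · exact hself _
    · exact h0
    · exact h1
    · rw [hsw, h0]
    · exact hself _

/-! ### The change of variables is a diffeomorphism -/

/-- The inverse of a smooth family of bijections `φ t` of the line, with nowhere vanishing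
derivatives, depends smoothly on all variables: the inverse function theorem applies to
`(t, y) ↦ (t, φ t y)`. -/
theorem contDiffOn_fibrewise_inverse {φ ψ : ℝ → ℝ → ℝ}
    (hφ : ContDiffOn ℝ ∞ (fun p : ℝ × ℝ => φ p.1 p.2) (Set.Ioi 0 ×ˢ Set.univ))
    (hbij : ∀ t : ℝ, 0 < t → Function.Bijective (φ t) ∧ ∀ y : ℝ, deriv (φ t) y ≠ 0)
    (hψ : ∀ t : ℝ, 0 < t → ∀ y, φ t (ψ t y) = y) :
    ContDiffOn ℝ ∞ (fun p : ℝ × ℝ => ψ p.1 p.2) (Set.Ioi 0 ×ˢ Set.univ) := by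
  rintro ⟨t, z⟩ ⟨ht, -⟩
  refine ContDiffAt.contDiffWithinAt ?_
  simp only [Set.mem_Ioi] at ht
  have h1 := contDiffAt_casimirs hφ (y := ψ t z) ht
  have h1d := (h1.differentiableAt (by simp)).hasFDerivAt
  set a := fderiv ℝ (fun p : ℝ × ℝ => φ p.1 p.2) (t, ψ t z) with ha
  have hb : a (0, 1) ≠ 0 := by
    have hc : HasDerivAt (fun y : ℝ => (t, y)) ((0 : ℝ), (1 : ℝ)) (ψ t z) :=
      (hasDerivAt_const _ t).prodMk (hasDerivAt_id _)
    have h2 := h1d.comp_hasDerivAt (ψ t z) hc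
    have h3 : HasDerivAt (φ t) (a (0, 1)) (ψ t z) := h2
    rw [← h3.deriv]
    exact (hbij t ht).2 _
  have hsplit : ∀ v : ℝ × ℝ, a v = v.1 * a (1, 0) + v.2 * a (0, 1) := by
    intro v
    have : v = v.1 • (1, 0) + v.2 • (0, 1) := by simp
    conv_lhs => rw [this, map_add, map_smul, map_smul, smul_eq_mul, smul_eq_mul]
  -- the derivative of `(t, y) ↦ (t, φ t y)` is triangular, hence invertible
  let e : (ℝ × ℝ) ≃L[ℝ] ℝ × ℝ := ContinuousLinearEquiv.equivOfInverse
    ((ContinuousLinearMap.fst ℝ ℝ ℝ).prod a)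
    ((ContinuousLinearMap.fst ℝ ℝ ℝ).prod ((a (0, 1))⁻¹ •
      (ContinuousLinearMap.snd ℝ ℝ ℝ - a (1, 0) • ContinuousLinearMap.fst ℝ ℝ ℝ)))
    (fun v => by
      ext
      · simp
      · simp [hsplit v]
        field_simp
        ring)
    (fun v => by
      ext
      · simp
      · simp [hsplit (v.1, _)]
        field_simp
        ring)
  have hΦ : ContDiffAt ℝ ∞ (fun p : ℝ × ℝ => (p.1, φ p.1 p.2)) (t, ψ t z) :=
    contDiffAt_fst.prodMk h1
  have hΦd : HasFDerivAt (fun p : ℝ × ℝ => (p.1, φ p.1 p.2)) (e : ℝ × ℝ →L[ℝ] ℝ × ℝ)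
      (t, ψ t z) := hasFDerivAt_fst.prodMk h1d
  have hinf : (∞ : WithTop ℕ∞) ≠ 0 := by simp
  have hloc := hΦ.to_localInverse hΦd hinf
  have hstr := hΦ.hasStrictFDerivAt' hΦd hinf
  have hr := hstr.eventually_right_inverse
  simp only [hψ t ht z] at hloc hr
  refine hloc.snd.congr_of_eventuallyEq ?_
  have hpos : ∀ᶠ p : ℝ × ℝ in nhds (t, z), 0 < p.1 :=
    (isOpen_Ioi.preimage continuous_fst).mem_nhds ht
  filter_upwards [hr, hpos] with p hp hp0
  refine (hbij p.1 hp0).1.1 ?_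
  rw [hψ p.1 hp0]
  have hp1 := congrArg Prod.fst hp
  have hp2 := congrArg Prod.snd hp
  simp only at hp1 hp2
  rw [hp1] at hp2
  exact hp2.symm

end

section

variable {I : Fin 3 → ℝ} {d : ℝ} {V : Set (Fin 3 → ℝ)} {K : (Fin 3 → ℝ) → ℝ}

theorem contDiffAt_changeOfVariables (hb0 : bCoef I d 0 ≠ 0) (hb1 : bCoef I d 1 ≠ 0)
    (hV : IsOpen V) (hsub : V ⊆ goodGamma I d) (hK : ContDiffOn ℝ ∞ K V) {φ : ℝ → ℝ → ℝ}
    (hφ : ContDiffOn ℝ ∞ (fun p : ℝ × ℝ => φ p.1 p.2) (Set.Ioi 0 ×ˢ Set.univ)) {x : Phase}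
    (hx : gam x ∈ V) :
    ContDiffAt ℝ ∞ (changeOfVariables I d (fun γ => K γ / factorN I d γ) φ) x := by
  have hgood := hsub hx
  have hgam : ContDiffAt ℝ ∞ gam x := contDiff_gam.contDiffAt
  have hC : ContDiffAt ℝ ∞ (fun y => φ (gam y ⬝ᵥ gam y) (C2 I d y)) x :=
    (contDiffAt_casimirs hφ (y := C2 I d x) (gam_dotProduct_pos hgood.2.2)).comp x
      (f := fun y => (gam y ⬝ᵥ gam y, C2 I d y))
      (contDiff_gam_dotProduct.contDiffAt.prodMk (contDiff_C2 I d).contDiffAt)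
  refine contDiffAt_pi.2 ?_
  rintro (i | i)
  · exact contDiffAt_pi.1 hgam i
  · have hS : ContDiffAt ℝ ∞ (fun y => symSMom (bCoef I d) d y i) x := by
      unfold symSMom Matrix.mulVec dotProduct
      refine ContDiffAt.sum fun j _ => ((contDiff_symS _ d i j).comp contDiff_gam).contDiffAt.mul ?_
      unfold mom
      fun_prop
    have hθ : ContDiffAt ℝ ∞ (fun γ => shiftField I d K γ i) (gam x) :=
      ((contDiffAt_factorN hb0 hb1 hgood).mul (contDiff_shiftNum _ d i).contDiffAt).add
        ((hK.contDiffAt (hV.mem_nhds hx)).mul (contDiffAt_meridianField hgood.2.2 i))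
    have h := (((contDiffAt_factorS hgood).comp x hgam).mul hS).add
      (((contDiff_C2 I d).contDiffAt.mul (hθ.comp x hgam)).add
        (hC.mul ((contDiffAt_axisField hgood.2.2 i).comp x hgam)))
    refine h.congr_of_eventuallyEq ?_
    filter_upwards [(hV.preimage contDiff_gam.continuous).mem_nhds hx] with y hy
    exact newMom_eq_shifted hb0 hb1 (hsub hy) _ i

/-- The vector `f 𝐒 M` recovered from the new momenta: the multiples of `θ` and `η` are
subtracted, the Casimir function `C₂` being `ψ (γ, γ) (γ, L)` for the inverse `ψ t` of `φ t`. -/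
def unshiftedMom (I : Fin 3 → ℝ) (d : ℝ) (K : (Fin 3 → ℝ) → ℝ) (ψ : ℝ → ℝ → ℝ) (y : Phase)
    (i : Fin 3) : ℝ :=
  mom y i - (ψ (gam y ⬝ᵥ gam y) (gam y ⬝ᵥ mom y) * shiftField I d K (gam y) i
    + (gam y ⬝ᵥ mom y) * axisField (gam y) i)

/-- The inverse of the change of variables. The matrix `𝐒` is inverted by its adjugate, and
`-g / 2d` is the inverse of `f s`. -/
def inverseChange (I : Fin 3 → ℝ) (d : ℝ) (K : (Fin 3 → ℝ) → ℝ) (ψ : ℝ → ℝ → ℝ) (y : Phase) :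
    Phase :=
  Sum.elim (gam y) fun i =>
    -(g I d (gam y) / (2 * d)) * (adjS (bCoef I d) d (gam y) *ᵥ unshiftedMom I d K ψ y) i

theorem contDiffAt_inverseChange (hb0 : bCoef I d 0 ≠ 0) (hb1 : bCoef I d 1 ≠ 0)
    (hV : IsOpen V) (hsub : V ⊆ goodGamma I d) (hK : ContDiffOn ℝ ∞ K V) {ψ : ℝ → ℝ → ℝ}
    (hψ : ContDiffOn ℝ ∞ (fun p : ℝ × ℝ => ψ p.1 p.2) (Set.Ioi 0 ×ˢ Set.univ)) {x : Phase}
    (hx : gam x ∈ V) : ContDiffAt ℝ ∞ (inverseChange I d K ψ) x := by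
  have hgood := hsub hx
  have hgam : ContDiffAt ℝ ∞ gam x := contDiff_gam.contDiffAt
  have hc : ContDiffAt ℝ ∞ (fun y : Phase => gam y ⬝ᵥ mom y) x := by
    unfold gam mom dotProduct
    fun_prop
  have hC : ContDiffAt ℝ ∞ (fun y => ψ (gam y ⬝ᵥ gam y) (gam y ⬝ᵥ mom y)) x :=
    (contDiffAt_casimirs hψ (y := gam x ⬝ᵥ mom x) (gam_dotProduct_pos hgood.2.2)).comp x
      (f := fun y => (gam y ⬝ᵥ gam y, gam y ⬝ᵥ mom y))
      (contDiff_gam_dotProduct.contDiffAt.prodMk hc)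
  have hN : ∀ i, ContDiffAt ℝ ∞ (fun y => unshiftedMom I d K ψ y i) x := fun i => by
    have hθ : ContDiffAt ℝ ∞ (fun γ => shiftField I d K γ i) (gam x) :=
      ((contDiffAt_factorN hb0 hb1 hgood).mul (contDiff_shiftNum _ d i).contDiffAt).add
        ((hK.contDiffAt (hV.mem_nhds hx)).mul (contDiffAt_meridianField hgood.2.2 i))
    have hM : ContDiffAt ℝ ∞ (fun y : Phase => mom y i) x := by
      unfold mom
      fun_prop
    exact hM.sub ((hC.mul (hθ.comp x hgam)).add
      (hc.mul ((contDiffAt_axisField hgood.2.2 i).comp x hgam)))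
  refine contDiffAt_pi.2 ?_
  rintro (i | i)
  · exact contDiffAt_pi.1 hgam i
  · refine ((((contDiffAt_g hgood.1).comp x hgam).div_const _).neg).mul ?_
    unfold Matrix.mulVec dotProduct
    exact ContDiffAt.sum fun j _ =>
      ((contDiff_adjS _ d i j).comp contDiff_gam).contDiffAt.mul (hN j)

theorem inverseChange_changeOfVariables (hd : 0 < d) (hb0 : bCoef I d 0 ≠ 0)
    (hb1 : bCoef I d 1 ≠ 0) {φ ψ : ℝ → ℝ → ℝ} {x : Phase} (hx : gam x ∈ goodGamma I d)
    (hψ : ψ (gam x ⬝ᵥ gam x) (φ (gam x ⬝ᵥ gam x) (C2 I d x)) = C2 I d x) :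
    inverseChange I d K ψ (changeOfVariables I d (fun γ => K γ / factorN I d γ) φ x) = x := by
  set F := changeOfVariables I d (fun γ => K γ / factorN I d γ) φ with hF
  have hγ : gam (F x) = gam x := rfl
  have hm : ∀ i, mom (F x) i = newMom I d (fun γ => K γ / factorN I d γ)
    (φ (gam x ⬝ᵥ gam x) (C2 I d x)) x i := fun i => rfl
  have hc : gam x ⬝ᵥ mom (F x) = φ (gam x ⬝ᵥ gam x) (C2 I d x) := gam_newMom hb0 hb1 hx _
  have hN : unshiftedMom I d K ψ (F x)
      = factorS I d (gam x) • (symS (bCoef I d) d (gam x) *ᵥ mom x) := by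
    ext i
    simp only [unshiftedMom, hγ, hc, hψ, hm, newMom_eq_shifted hb0 hb1 hx]
    simp [symSMom]
  have hg := (g_pos hx.1).ne'
  have hs := hx.2.1
  ext (i | i)
  · rfl
  · show -(g I d (gam x) / (2 * d)) * (adjS (bCoef I d) d (gam x) *ᵥ unshiftedMom I d K ψ (F x)) i
      = x (.inr i)
    rw [hN, Matrix.mulVec_smul, Matrix.mulVec_mulVec, adjS, Matrix.adjugate_mul, ← sFun_eq_det,
      Matrix.smul_mulVec, Matrix.one_mulVec]
    simp only [Pi.smul_apply, smul_eq_mul, factorS, mom]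
    field_simp

theorem changeOfVariables_inverseChange (hd : 0 < d) (hb0 : bCoef I d 0 ≠ 0)
    (hb1 : bCoef I d 1 ≠ 0) {φ ψ : ℝ → ℝ → ℝ} {y : Phase} (hy : gam y ∈ goodGamma I d)
    (hψ : φ (gam y ⬝ᵥ gam y) (ψ (gam y ⬝ᵥ gam y) (gam y ⬝ᵥ mom y)) = gam y ⬝ᵥ mom y) :
    changeOfVariables I d (fun γ => K γ / factorN I d γ) φ (inverseChange I d K ψ y) = y := by
  set x := inverseChange I d K ψ y with hxdef
  have hγ : gam x = gam y := rfl
  have hx : gam x ∈ goodGamma I d := hy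
  have hg := (g_pos hy.1).ne'
  have hs := hy.2.1
  have hf : factorS I d (gam y) ≠ 0 := by
    unfold factorS
    positivity
  have hmom : mom x = -(g I d (gam y) / (2 * d)) •
      (adjS (bCoef I d) d (gam y) *ᵥ unshiftedMom I d K ψ y) := rfl
  have hSM : ∀ i, factorS I d (gam y) * symSMom (bCoef I d) d x i = unshiftedMom I d K ψ y i := by
    intro i
    rw [symSMom, hγ, hmom, Matrix.mulVec_smul, Matrix.mulVec_mulVec, adjS, Matrix.mul_adjugate,
      ← sFun_eq_det, Matrix.smul_mulVec, Matrix.one_mulVec]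
    simp only [Pi.smul_apply, smul_eq_mul, factorS]
    field_simp
  have hC : C2 I d x = ψ (gam y ⬝ᵥ gam y) (gam y ⬝ᵥ mom y) := by
    have h1 := gam_symSMom I d x
    have h2 := gam_shiftField (K := K) hb0 hb1 hy
    have h3 := sum_gam_axisField hy.2.2
    have h4 : gam y ⬝ᵥ mom y = ∑ i, gam y i * mom y i := rfl
    -- pair `f 𝐒 M = L - C θ - c η` with `γ`, and use `(γ, θ) = -f`, `(γ, η) = 1`, `c = (γ, L)`
    refine mul_left_cancel₀ hf ?_
    have e := hSM
    simp only [unshiftedMom] at e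
    generalize ψ (gam y ⬝ᵥ gam y) (gam y ⬝ᵥ mom y) = C at *
    generalize gam y ⬝ᵥ mom y = c at *
    simp only [hγ, Fin.sum_univ_three] at h1 h2 h3 h4
    linear_combination -factorS I d (gam y) * h1 + gam y 0 * e 0 + gam y 1 * e 1 + gam y 2 * e 2
      - C * h2 - c * h3 - h4
  ext (i | i)
  · rfl
  · show newMom I d (fun γ => K γ / factorN I d γ) (φ (gam x ⬝ᵥ gam x) (C2 I d x)) x i = mom y i
    rw [newMom_eq_shifted hb0 hb1 hx, hC, hγ, hψ, hSM, unshiftedMom]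
    ring

theorem isDiffeoOn_changeOfVariables (hd : 0 < d) (hb0 : bCoef I d 0 ≠ 0) (hb1 : bCoef I d 1 ≠ 0)
    (hV : IsOpen V) (hsub : V ⊆ goodGamma I d) (hK : ContDiffOn ℝ ∞ K V) {φ : ℝ → ℝ → ℝ}
    (hφ : ContDiffOn ℝ ∞ (fun p : ℝ × ℝ => φ p.1 p.2) (Set.Ioi 0 ×ˢ Set.univ))
    (hbij : ∀ t : ℝ, 0 < t → Function.Bijective (φ t) ∧ ∀ y : ℝ, deriv (φ t) y ≠ 0) :
    IsDiffeoOn (changeOfVariables I d (fun γ => K γ / factorN I d γ) φ)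
      {x | gam x ∈ V} {x | gam x ∈ V} := by
  have hex : ∀ t z : ℝ, ∃ y, 0 < t → φ t y = z := fun t z => by
    by_cases ht : 0 < t
    · obtain ⟨y, hy⟩ := (hbij t ht).1.2 z
      exact ⟨y, fun _ => hy⟩
    · exact ⟨0, fun h => absurd h ht⟩
  -- for `t ≤ 0` the values of `ψ t` are arbitrary
  choose ψ hψ using hex
  have hφψ : ∀ t : ℝ, 0 < t → ∀ z, φ t (ψ t z) = z := fun t ht z => hψ t z ht
  have hψφ : ∀ t : ℝ, 0 < t → ∀ y, ψ t (φ t y) = y := fun t ht y =>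
    (hbij t ht).1.1 (hφψ t ht _)
  have hψs := contDiffOn_fibrewise_inverse hφ hbij hφψ
  have hpos : ∀ {x : Phase}, gam x ∈ V → 0 < gam x ⬝ᵥ gam x := fun hx =>
    gam_dotProduct_pos (hsub hx).2.2
  have hopen : IsOpen {x : Phase | gam x ∈ V} := hV.preimage contDiff_gam.continuous
  have hF : ContDiffOn ℝ ∞ (changeOfVariables I d (fun γ => K γ / factorN I d γ) φ)
      {x | gam x ∈ V} := fun x hx =>
    (contDiffAt_changeOfVariables hb0 hb1 hV hsub hK hφ hx).contDiffWithinAt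
  have hG : ContDiffOn ℝ ∞ (inverseChange I d K ψ) {x | gam x ∈ V} := fun x hx =>
    (contDiffAt_inverseChange hb0 hb1 hV hsub hK hψs hx).contDiffWithinAt
  exact ⟨{ toFun := changeOfVariables I d (fun γ => K γ / factorN I d γ) φ
           invFun := inverseChange I d K ψ
           source := {x | gam x ∈ V}
           target := {x | gam x ∈ V}
           map_source' := fun x hx => hx
           map_target' := fun x hx => hx
           left_inv' := fun x hx =>
             inverseChange_changeOfVariables hd hb0 hb1 (hsub hx) (hψφ _ (hpos hx) _)
           right_inv' := fun x hx =>
             changeOfVariables_inverseChange hd hb0 hb1 (hsub hx) (hφψ _ (hpos hx) _)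
           open_source := hopen
           open_target := hopen
           continuousOn_toFun := hF.continuousOn
           continuousOn_invFun := hG.continuousOn },
    rfl, rfl, fun _ _ => rfl, hF, hG⟩

end

end ChaplyginSphere

end

theorem proposition4 (I : Fin 3 → ℝ) (d : ℝ) (hI : ∀ i, 0 < I i) (hd : 0 < d)
    (hasym : ∃ i j, I i ≠ I j) :
    -- `P_b` is a Poisson bivector
    IsPoissonOn (Pb I d) (regularSet I d) ∧
    -- `P_g` is compatible with `P`
    CompatibleOn canonicalP (Pg I d) (regularSet I d) ∧
    -- `P_b` is incompatible with `P`, on every nonempty open set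
    (∀ W : Set Phase, IsOpen W → W.Nonempty → W ⊆ regularSet I d →
      ¬ CompatibleOn canonicalP (Pb I d) W) ∧
    -- `P_b` is not a trivial deformation of `P`, on every nonempty open set
    (∀ W : Set Phase, IsOpen W → W.Nonempty → W ⊆ regularSet I d →
      ¬ IsTrivialDeformationOn canonicalP (Pb I d) W) ∧
    -- the change of variables takes `P_b` to `P`
    (bCoef I d 0 ≠ 0 → bCoef I d 1 ≠ 0 →
      ∀ V : Set (Fin 3 → ℝ), IsOpen V → V ⊆ goodGamma I d →
        (∀ γ ∈ V, IsPreconnected (V ∩ meridian γ)) →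
        ∃ h : (Fin 3 → ℝ) → ℝ, ContDiffOn ℝ ∞ h V ∧
          ∀ φ : ℝ → ℝ → ℝ,
            ContDiffOn ℝ ∞ (fun p : ℝ × ℝ => φ p.1 p.2) (Set.Ioi 0 ×ˢ Set.univ) →
            (∀ x : Phase, gam x ∈ V →
              gam x ⬝ᵥ newMom I d h (φ (gam x ⬝ᵥ gam x) (C2 I d x)) x
                = φ (gam x ⬝ᵥ gam x) (C2 I d x)) ∧
            TakesTo (changeOfVariables I d h φ) (Pb I d) canonicalP {x | gam x ∈ V} ∧
            ((∀ t : ℝ, 0 < t → Function.Bijective (φ t) ∧ ∀ y : ℝ, deriv (φ t) y ≠ 0) →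
              IsDiffeoOn (changeOfVariables I d h φ) {x | gam x ∈ V} {x | gam x ∈ V})) := by
  refine ⟨isPoissonOn_Pb hI hd, compatibleOn_Pg I d,
    fun W hW hne hsub => not_compatibleOn_Pb hI hd hasym hW hne hsub,
    fun W hW hne hsub => not_isTrivialDeformationOn_Pb hI hd hasym hW hne hsub,
    fun hb0 hb1 V hV hsub hconn => ?_⟩
  obtain ⟨K, hK, hdiv⟩ := exists_div_shiftField hb0 hb1 hV hsub hconn
  refine ⟨fun γ => K γ / factorN I d γ, fun γ hγ => (hK γ hγ).div
      (contDiffAt_factorN hb0 hb1 (hsub hγ)).contDiffWithinAt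
      (factorN_ne_zero hb0 hb1 (hsub hγ)), fun φ hφ => ⟨fun x hx => gam_newMom hb0 hb1 (hsub hx) _,
    takesTo_changeOfVariables hI hd hb0 hb1 hV hsub hK hdiv hφ,
    isDiffeoOn_changeOfVariables hd hb0 hb1 hV hsub hK hφ⟩⟩
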